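/- Let $d\ge 2$. A convex polyhedron in $\mathbb{R}^d$ means a bounded finite intersection of closed half-spaces with non-empty interior. For a pair $p=(d_1,d_2)$, $d_1<d_2$, of dimensions let $\Pi_p:\mathbb{R}^d\to\mathbb{R}^2$ be the coordinate projection, let $PE$ denote the perimeter (length of the boundary) of a convex region of the plane, and for a convex set $B$ put $\Lambda(B)=\sum_p PE(\Pi_p(B))$. For $K\subset\mathbb{R}^2$ let $\ell_K(\theta)=\{x_1\cos\theta+x_2\sin\theta : x\in K\}$ be its projection onto the line in direction $\theta$. The extended BSP-tree process with budget $\tau>0$ on a convex polyhedron $\square$ is the following random sequence of hierarchical partitions of $\square$. At time $\tau_0=0$ there is one block, $\square$. Given the partition at time $\tau_{l-1}$, with blocks $\square^{(1)},\dots,\square^{(l)}$: (1) choose a block $\square^{(*)}$ with probability proportional to $\Lambda(\square^{(k)})$; (2) choose a pair $p$ of dimensions with probability proportional to $PE(\Pi_p(\square^{(*)}))$; (3) choose $\theta\in(0,\pi]$ with density proportional to the length of $\ell_K(\theta)$, where $K=\Pi_p(\square^{(*)})$, and then $u$ uniformly on $\ell_K(\theta)$; the proposed cut is the hyperplane $\{x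 : x_{d_1}\cos\theta+x_{d_2}\sin\theta=u\}$, which is parallel to the other $d-2$ coordinate axes; (4) independently choose $\tau_l-\tau_{l-1}$ exponentially distributed with rate $\sum_{k=1}^l\Lambda(\square^{(k)})$. If $\tau_l>\tau$ the procedure stops and the current partition is returned; otherwise $\square^{(*)}$ is replaced by its two parts strictly on either side of the hyperplane, and the procedure continues. For $t\in(0,\tau]$ let $\boxplus^{\square}_t$ be the hierarchical partition at time $t$, that is, the binary tree of the cuts $(p,\theta,u)$ made up to time $t$. The restriction of a hierarchical partition to a convex polyhedron $\triangle\subseteq\square$ is the hierarchical partition of $\triangle$ obtained by deleting every cut whose hyperplane does not meet the part of $\triangle$ in its node, the child that contains this part taking the place of the node; its non-empty blocks are the non-empty intersections of the original blocks with $\triangle$. Then for all convex polyhedra $\triangle\subseteq\square$ in $\mathbb{R}^d$ and every $\tau>0$, the procedures on $\square$ and on $\triangle$ with budget $\tau$ stop after finitely many cuts almost surely, and the process $(\boxplus^{\square}_t|_{\triangle})_{t\in(0,\tau]}$ obtained by restricting the process on $\square$ to $\triangle$ has the same distribution as the process $(\boxplus^{\triangle}_t)_{t\in(0,\tau]}$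 run directly on $\triangle$. -/

import Mathlib

open MeasureTheory ProbabilityTheory Set
open scoped ENNReal

namespace BSP

noncomputable section

/-! ### Convex polyhedra, planar projections, perimeters -/

/-- A (full-dimensional, bounded) closed convex polyhedron: a bounded finite intersection of closed
half-spaces which has an interior point. -/
def IsConvexPolyhedron {d : ℕ} (P : Set (EuclideanSpace ℝ (Fin d))) : Prop :=
  (∃ H : Finset (EuclideanSpace ℝ (Fin d) × ℝ), P = {x | ∀ h ∈ H, inner ℝ h.1 x ≤ h.2}) ∧
    Bornology.IsBounded P ∧ (interior P).Nonempty

/-- The `d (d - 1) / 2` unordered pairs of distinct dimensions. -/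
abbrev DimPair (d : ℕ) : Type := {p : Fin d × Fin d // p.1 < p.2}

/-- Coordinate projection onto the pair of dimensions `p`. -/
def proj {d : ℕ} (p : DimPair d) (x : EuclideanSpace ℝ (Fin d)) : EuclideanSpace ℝ (Fin 2) :=
  !₂[x p.1.1, x p.1.2]

/-- The perimeter of a convex region of the plane: the length (one-dimensional Hausdorff measure)
of its boundary. -/
def perimeter (K : Set (EuclideanSpace ℝ (Fin 2))) : ℝ≥0∞ :=
  Measure.hausdorffMeasure 1 (frontier K)

/-- Sum of the perimeters of the projections of a block onto all pairs of dimensions. -/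
def totalPerimeter {d : ℕ} (B : Set (EuclideanSpace ℝ (Fin d))) : ℝ≥0∞ :=
  ∑ p : DimPair d, perimeter (proj p '' B)

/-- The projection of the planar set `K` onto the line through the origin in direction
`(cos θ, sin θ)`; a point of this line is recorded by its signed distance to the origin. -/
def segment (K : Set (EuclideanSpace ℝ (Fin 2))) (θ : ℝ) : Set ℝ :=
  (fun x : EuclideanSpace ℝ (Fin 2) => x 0 * Real.cos θ + x 1 * Real.sin θ) '' K

/-! ### Cuts and hierarchical partitions -/

/-- A cutting hyperplane: its two free dimensions, the direction `θ` of its normal in the plane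
of these two dimensions, and its position `u` on the line in direction `θ`. -/
abbrev Cut (d : ℕ) : Type := DimPair d × ℝ × ℝ

/-- The affine function whose zero set is the cutting hyperplane. -/
def Cut.eval {d : ℕ} (c : Cut d) (x : EuclideanSpace ℝ (Fin d)) : ℝ :=
  x c.1.1.1 * Real.cos c.2.1 + x c.1.1.2 * Real.sin c.2.1 - c.2.2

/-- One of the two open sides of a cutting hyperplane. -/
def Cut.neg {d : ℕ} (c : Cut d) : Set (EuclideanSpace ℝ (Fin d)) := {x | c.eval x < 0}

/-- The other open side of a cutting hyperplane. -/
def Cut.pos {d : ℕ} (c : Cut d) : Set (EuclideanSpace ℝ (Fin d)) := {x | 0 < c.eval x}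

/-- Measurable boxes of binary trees: trees of a given shape, each of whose labels is constrained
to a given measurable set. -/
inductive IsBox {L : Type} [MeasurableSpace L] : Set (BinaryTree L) → Prop
  | nil : IsBox {BinaryTree.nil}
  | node {A : Set L} {S S' : Set (BinaryTree L)} (hA : MeasurableSet A) (hS : IsBox S)
      (hS' : IsBox S') :
      IsBox {T | ∃ a ∈ A, ∃ l ∈ S, ∃ r ∈ S', T = BinaryTree.node a l r}

/-- The sigma-algebra on labelled binary trees: the disjoint union, over the countably many shapes,
of the product sigma-algebras of the labels. -/
instance instMeasurableSpaceBinaryTree {L : Type} [MeasurableSpace L] :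
    MeasurableSpace (BinaryTree L) :=
  MeasurableSpace.generateFrom {S | IsBox S}

/-- The terminal nodes (from left to right) of the hierarchical partition of `B` given by a tree
whose labels `x` carry the cuts `cut x`. Each terminal node is given by its block together with
the operation that replaces it by an internal node with two terminal children. -/
def leaves {d : ℕ} {L : Type} (cut : L → Cut d) (B : Set (EuclideanSpace ℝ (Fin d))) :
    BinaryTree L → List (Set (EuclideanSpace ℝ (Fin d)) × (L → BinaryTree L))
  | .nil => [(B, fun x => .node x .nil .nil)]
  | .node a l r =>
      (leaves cut (B ∩ (cut a).neg) l).map (fun b => (b.1, fun x => .node a (b.2 x) r)) ++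
      (leaves cut (B ∩ (cut a).pos) r).map (fun b => (b.1, fun x => .node a l (b.2 x)))

/-- The blocks of the hierarchical partition of `B` given by a tree of cuts. -/
def blocks {d : ℕ} (B : Set (EuclideanSpace ℝ (Fin d))) (T : BinaryTree (Cut d)) :
    List (Set (EuclideanSpace ℝ (Fin d))) :=
  (leaves id B T).map Prod.fst

open Classical in
/-- Restriction of a hierarchical partition to `B`: a cut which does not meet the (convex) part of `B`
that reaches it is deleted, and the child that contains this part takes its place. -/
def restrict {d : ℕ} (B : Set (EuclideanSpace ℝ (Fin d))) :
    BinaryTree (Cut d) → BinaryTree (Cut d)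
  | .nil => .nil
  | .node c l r =>
      if B ⊆ c.neg then restrict B l
      else if B ⊆ c.pos then restrict B r
      else .node c (restrict (B ∩ c.neg) l) (restrict (B ∩ c.pos) r)

/-! ### The generative process -/

/-- A hierarchical partition in which every cut carries the time at which it was made. -/
abbrev TimedTree (d : ℕ) : Type := BinaryTree (ℝ × Cut d)

/-- The hierarchical partition at time `t`: keep the cuts made up to time `t`. -/
def TimedTree.at {d : ℕ} (t : ℝ) : TimedTree d → BinaryTree (Cut d)
  | .nil => .nil
  | .node a l r => if a.1 ≤ t then .node a.2 (TimedTree.at t l) (TimedTree.at t r) else .nil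

/-- Law of the direction: the density on `(0, π]` is proportional to the length of the projected
segment. -/
def directionLaw (K : Set (EuclideanSpace ℝ (Fin 2))) : Measure ℝ :=
  (∫⁻ θ in Ioc 0 Real.pi, volume (segment K θ))⁻¹ •
    (volume.restrict (Ioc 0 Real.pi)).withDensity (fun θ => volume (segment K θ))

/-- Law of a cutting line `(θ, u)` of a planar region: given `θ`, the position `u` is uniform on
the projected segment. -/
def lineLaw (K : Set (EuclideanSpace ℝ (Fin 2))) : Measure (ℝ × ℝ) :=
  (directionLaw K).bind fun θ => (cond volume (segment K θ)).map fun u => (θ, u)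

/-- One step of the process on `P`, from a state made of the time of the last cut and the current
hierarchical partition, to the proposed next cut time and the proposed next partition:
choose a terminal node in proportion to its total perimeter, a pair of dimensions in proportion
to the perimeter of the projection of that node, a cutting line of this projection, and an
exponential incremental time whose rate is the sum of the total perimeters of all blocks. -/
def step {d : ℕ} (P : Set (EuclideanSpace ℝ (Fin d))) (s : ℝ × TimedTree d) :
    Measure (ℝ × TimedTree d) :=
  let ls := leaves Prod.snd P s.2
  let rate : ℝ≥0∞ := (ls.map fun b => totalPerimeter b.1).sum
  (ls.map fun b => (totalPerimeter b.1 / rate) •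
    ∑ p : DimPair d, (perimeter (proj p '' b.1) / totalPerimeter b.1) •
      ((expMeasure rate.toReal).prod (lineLaw (proj p '' b.1))).map
        fun y => (s.1 + y.1, b.2 (s.1 + y.1, (p, y.2)))).sum

/-- The (sub-probability) law of the state after `n` cuts, on the event that at least `n` cuts are
accepted within the budget `τ`. -/
def accepted {d : ℕ} (P : Set (EuclideanSpace ℝ (Fin d))) (τ : ℝ) : ℕ → Measure (ℝ × TimedTree d)
  | 0 => Measure.dirac (0, BinaryTree.nil)
  | n + 1 => ((accepted P τ n).bind (step P)).restrict {s | s.1 ≤ τ}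

/-- The law of the realisation with budget `τ` of the process on `P`: the current partition is
returned as soon as the next proposed cut time exceeds `τ`. -/
def law {d : ℕ} (P : Set (EuclideanSpace ℝ (Fin d))) (τ : ℝ) : Measure (TimedTree d) :=
  Measure.sum fun n : ℕ =>
    ((accepted P τ n).withDensity fun s => step P s {s' | τ < s'.1}).map Prod.snd

end

section

variable {d : ℕ}

lemma blocks_nil (B : Set (EuclideanSpace ℝ (Fin d))) : blocks B .nil = [B] := rfl

lemma blocks_node (B : Set (EuclideanSpace ℝ (Fin d))) (c : Cut d) (l r : BinaryTree (Cut d)) :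
    blocks B (.node c l r) = blocks (B ∩ c.neg) l ++ blocks (B ∩ c.pos) r := by
  simp [blocks, leaves, Function.comp_def]

lemma blocks_empty (T : BinaryTree (Cut d)) :
    ∀ b ∈ blocks (∅ : Set (EuclideanSpace ℝ (Fin d))) T, b = ∅ := by
  induction T with
  | nil => simp [blocks_nil]
  | node c l r hl hr =>
    intro b hb
    rw [blocks_node, empty_inter, empty_inter, List.mem_append] at hb
    exact hb.elim (hl b) (hr b)

lemma blocks_inter (B Q : Set (EuclideanSpace ℝ (Fin d))) (T : BinaryTree (Cut d)) :
    blocks (B ∩ Q) T = (blocks B T).map (· ∩ Q) := by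
  induction T generalizing B with
  | nil => rfl
  | node c l r hl hr =>
    rw [blocks_node, blocks_node, List.map_append, ← hl, ← hr, inter_right_comm,
      inter_right_comm B Q]

open Classical in
lemma blocks_restrict_self (B : Set (EuclideanSpace ℝ (Fin d))) (T : BinaryTree (Cut d)) :
    (blocks B (restrict B T)).filter (fun b => b.Nonempty) =
      (blocks B T).filter (fun b => b.Nonempty) := by
  have hdisj : ∀ c : Cut d, c.neg ∩ c.pos = ∅ := fun c => by
    ext x
    simp only [Cut.neg, Cut.pos, mem_inter_iff, mem_ofPred_eq, mem_empty_iff_false, iff_false]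
    exact fun h => lt_asymm h.1 h.2
  have hemp : ∀ T : BinaryTree (Cut d),
      (blocks (∅ : Set (EuclideanSpace ℝ (Fin d))) T).filter (fun b => b.Nonempty) = [] := by
    intro T
    rw [List.filter_eq_nil_iff]
    intro b hb
    simp [blocks_empty T b hb]
  induction T generalizing B with
  | nil => rfl
  | node c l r hl hr =>
    rw [restrict]
    split_ifs with h1 h2
    · have h3 : B ∩ c.pos = ∅ :=
        subset_empty_iff.1 ((inter_subset_inter_left _ h1).trans (hdisj c).le)
      rw [blocks_node, List.filter_append, h3, hemp, List.append_nil, inter_eq_left.2 h1, hl]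
    · have h3 : B ∩ c.neg = ∅ := by
        rw [inter_comm]
        exact subset_empty_iff.1 ((inter_subset_inter_right _ h2).trans (hdisj c).le)
      rw [blocks_node, List.filter_append, h3, hemp, List.nil_append, inter_eq_left.2 h2, hr]
    · rw [blocks_node, blocks_node, List.filter_append, List.filter_append, hl, hr]

open Classical in
/-- The blocks of the restriction to `Q ⊆ P` are the nonempty intersections of the blocks
with `Q`. -/
lemma blocks_restrict {P Q : Set (EuclideanSpace ℝ (Fin d))} (hQP : Q ⊆ P)
    (T : BinaryTree (Cut d)) :
    (blocks Q (restrict Q T)).filter (fun b => b.Nonempty) =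
      ((blocks P T).map (· ∩ Q)).filter (fun b => b.Nonempty) := by
  rw [blocks_restrict_self, ← blocks_inter, inter_eq_right.2 hQP]

end

end BSP

/-!
The lines of the plane carry an invariant measure `dθ du`, and by the Cauchy-Crofton formula the
perimeter of a convex polygon is the measure of the set of lines that meet it
(`perimeter_eq_lintegral`). It applies to the projections of the blocks, whose closures are
polytopes. Hence all the normalisations in the definition of the process cancel: a block is cut
by hyperplanes at a rate given by one fixed measure `cutMeasure` on the cuts, restricted to those
that hit the block (`IsBlock.lintegral_step`).

Consequently, if a hierarchical partition of `P` is restricted to `Q ⊆ P`, the cuts of its blocks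
that are visible in `Q` have the same intensity as for the process on `Q`, and the other ones leave
the restricted partition unchanged (`exists_leafInt_restrictBy_eq`). Let `f` be a nonnegative
function of the final partition of `Q`, and let `u` be its expectation for the process on `Q`, given
the current state. Adding fictitious jumps to the process on `Q` (`uniformisation`) shows that `u`,
evaluated at the restriction to `Q` of a partition of `P`, solves the backward equation of the
process on `P` (`finalInt_restrictBy`). The expectation of `f` of the restricted final partition of
`P` is the smallest nonnegative solution of this equation, so it is at most `u`
(`lintegral_law_le`): the law of the restricted process on `P` is dominated by the law of the
process on `Q`. Both are probability measures, so they are equal.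

That they are probability measures means that the process does not explode: the rate of the next cut
is at most linear in the number of blocks, as in the Yule process
(`IsBlock.isProbabilityMeasure_law`).

The transition kernel and the restriction map are measurable functions of the tree of cuts. This is
proved by recursion on the height of the tree, for blocks that depend measurably on
parameters in the sense of `HitMeasurable`.
-/

namespace BSP

/-! ### The sigma-algebra on labelled binary trees -/

section Trees

variable {L Y Z : Type} [MeasurableSpace L] [MeasurableSpace Y] [MeasurableSpace Z]

/-- The constructor `BinaryTree.node` as a function of a triple. -/
def nodeMap {L : Type} (w : L × BinaryTree L × BinaryTree L) : BinaryTree L := .node w.1 w.2.1 w.2.2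

lemma nodeMap_injective {L : Type} : Function.Injective (nodeMap (L := L)) := by
  rintro ⟨a, l, r⟩ ⟨a', l', r'⟩ h
  simpa [nodeMap] using h

lemma IsBox.measurableSet {S : Set (BinaryTree L)} (hS : IsBox S) : MeasurableSet S :=
  MeasurableSpace.measurableSet_generateFrom hS

lemma image_nodeMap_prod {L : Type} (A : Set L) (S S' : Set (BinaryTree L)) :
    nodeMap '' (A ×ˢ S ×ˢ S') =
      {T | ∃ a ∈ A, ∃ l ∈ S, ∃ r ∈ S', T = BinaryTree.node a l r} := by
  ext T
  simp only [nodeMap, mem_image, mem_prod, Prod.exists, mem_ofPred_eq]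
  grind

lemma IsBox.image_nodeMap {A : Set L} {S S' : Set (BinaryTree L)} (hA : MeasurableSet A)
    (hS : IsBox S) (hS' : IsBox S') : IsBox (nodeMap '' (A ×ˢ S ×ˢ S')) := by
  rw [image_nodeMap_prod]
  exact IsBox.node hA hS hS'

lemma measurable_nodeMap : Measurable (nodeMap (L := L)) := by
  refine measurable_generateFrom ?_
  rintro S (_ | ⟨hA, hS, hS'⟩)
  · convert MeasurableSet.empty
    ext w
    simp [nodeMap]
  · rw [← image_nodeMap_prod, preimage_image_eq _ nodeMap_injective]
    exact hA.prod (hS.measurableSet.prod hS'.measurableSet)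

/-- Countably many boxes, one for each shape, cover the space of trees. -/
lemma exists_countable_boxes :
    ∃ 𝒮 : Set (Set (BinaryTree L)), 𝒮.Countable ∧ (∀ S ∈ 𝒮, IsBox S) ∧ ⋃₀ 𝒮 = univ := by
  have key : ∀ n : ℕ, ∃ 𝒮 : Set (Set (BinaryTree L)), 𝒮.Countable ∧ (∀ S ∈ 𝒮, IsBox S) ∧
      ∀ T : BinaryTree L, T.height ≤ n → T ∈ ⋃₀ 𝒮 := by
    intro n
    induction n with
    | zero =>
      refine ⟨{{BinaryTree.nil}}, countable_singleton _, by simpa using IsBox.nil, ?_⟩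
      rintro (_ | ⟨a, l, r⟩) h
      · simp
      · simp at h
    | succ n ih =>
      obtain ⟨𝒮, hc, hbox, hcov⟩ := ih
      refine ⟨insert {BinaryTree.nil} (image2 (fun S S' => nodeMap '' (univ ×ˢ S ×ˢ S')) 𝒮 𝒮),
        (hc.image2 hc _).insert _, ?_, ?_⟩
      · rintro S (rfl | ⟨S, hS, S', hS', rfl⟩)
        · exact IsBox.nil
        · exact IsBox.image_nodeMap .univ (hbox _ hS) (hbox _ hS')
      · rintro (_ | ⟨a, l, r⟩) h
        · exact ⟨_, mem_insert _ _, rfl⟩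
        · simp only [BinaryTree.height, add_le_add_iff_right, sup_le_iff] at h
          obtain ⟨S, hS, hl⟩ := hcov l h.1
          obtain ⟨S', hS', hr⟩ := hcov r h.2
          exact ⟨_, mem_insert_of_mem _ ⟨S, hS, S', hS', rfl⟩,
            ⟨(a, l, r), ⟨mem_univ _, hl, hr⟩, rfl⟩⟩
  choose 𝒮 hc hbox hcov using key
  refine ⟨⋃ n, 𝒮 n, countable_iUnion hc, ?_, ?_⟩
  · intro S hS
    obtain ⟨n, hn⟩ := mem_iUnion.1 hS
    exact hbox n S hn
  · refine eq_univ_of_forall fun T => ?_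
    obtain ⟨S, hS, hT⟩ := hcov T.height T le_rfl
    exact ⟨S, mem_iUnion.2 ⟨_, hS⟩, hT⟩

lemma measurableEmbedding_nodeMap : MeasurableEmbedding (nodeMap (L := L)) := by
  refine ⟨nodeMap_injective, measurable_nodeMap, ?_⟩
  obtain ⟨𝒮, hc, hbox, hcov⟩ := exists_countable_boxes (L := L)
  have hrange : MeasurableSet (range (nodeMap (L := L))) := by
    have : range (nodeMap (L := L)) = ({BinaryTree.nil} : Set (BinaryTree L))ᶜ := by
      ext T
      cases T <;> simp [nodeMap]
    rw [this]
    exact (IsBox.nil.measurableSet).compl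
  have hbig : ∀ (A : Set L) (S S' : Set (BinaryTree L)), MeasurableSet A →
      (S = univ ∨ IsBox S) → (S' = univ ∨ IsBox S') →
      MeasurableSet (nodeMap '' (A ×ˢ S ×ˢ S')) := by
    intro A S S' hA hS hS'
    have hcov' : ∀ S : Set (BinaryTree L), (S = univ ∨ IsBox S) →
        ∃ 𝒯 : Set (Set (BinaryTree L)), 𝒯.Countable ∧ (∀ S ∈ 𝒯, IsBox S) ∧ ⋃₀ 𝒯 = S := by
      rintro S (rfl | hS)
      · exact ⟨𝒮, hc, hbox, hcov⟩
      · exact ⟨{S}, countable_singleton _, by simpa using hS, by simp⟩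
    obtain ⟨𝒯, h1, h2, rfl⟩ := hcov' S hS
    obtain ⟨𝒯', h1', h2', rfl⟩ := hcov' S' hS'
    have : nodeMap '' (A ×ˢ (⋃₀ 𝒯) ×ˢ (⋃₀ 𝒯')) =
        ⋃ S ∈ 𝒯, ⋃ S' ∈ 𝒯', nodeMap '' (A ×ˢ S ×ˢ S') := by
      ext T
      simp only [mem_image, mem_prod, mem_sUnion, mem_iUnion, Prod.exists]
      grind
    rw [this]
    exact .biUnion h1 fun S hS => .biUnion h1' fun S' hS' =>
      (IsBox.image_nodeMap hA (h2 S hS) (h2' S' hS')).measurableSet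
  have hle : (inferInstance : MeasurableSpace (L × BinaryTree L × BinaryTree L)) ≤
      MeasurableSpace.comap nodeMap inferInstance := by
    have hmk : ∀ W : Set (L × BinaryTree L × BinaryTree L), MeasurableSet (nodeMap '' W) →
        MeasurableSet[MeasurableSpace.comap nodeMap inferInstance] W := fun W hW =>
      ⟨_, hW, preimage_image_eq _ nodeMap_injective⟩
    refine sup_le ?_ ?_
    · rintro _ ⟨A, hA, rfl⟩
      refine hmk _ ?_
      convert hbig A univ univ hA (.inl rfl) (.inl rfl) using 2
      ext; simp
    · refine MeasurableSpace.comap_le_iff_le_map.2 (sup_le ?_ ?_)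
      · refine MeasurableSpace.comap_le_iff_le_map.2 (MeasurableSpace.generateFrom_le ?_)
        intro S hS
        refine hmk _ ?_
        convert hbig univ S univ .univ (.inr hS) (.inl rfl) using 2
        ext; simp
      · refine MeasurableSpace.comap_le_iff_le_map.2 (MeasurableSpace.generateFrom_le ?_)
        intro S hS
        refine hmk _ ?_
        convert hbig univ univ S .univ (.inl rfl) (.inr hS) using 2
        ext; simp
  intro W hW
  obtain ⟨S, hS, rfl⟩ := hle W hW
  rw [image_preimage_eq_inter_range]
  exact hS.inter hrange

/-- A function on trees which also depends on a parameter is measurable as soon as it is so on the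
empty tree and on the trees with a root. -/
lemma measurable_of_cases {h : Z × BinaryTree L → Y} (h0 : Measurable fun z => h (z, .nil))
    (h1 : Measurable fun w : Z × L × BinaryTree L × BinaryTree L => h (w.1, nodeMap w.2)) :
    Measurable h := by
  intro A hA
  have hemb : MeasurableEmbedding
      (Prod.map id nodeMap : Z × L × BinaryTree L × BinaryTree L → Z × BinaryTree L) :=
    MeasurableEmbedding.id.prodMap measurableEmbedding_nodeMap
  have : h ⁻¹' A = ((fun z => h (z, .nil)) ⁻¹' A) ×ˢ {BinaryTree.nil} ∪
      Prod.map id nodeMap '' ((fun w : Z × L × BinaryTree L × BinaryTree L =>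
        h (w.1, nodeMap w.2)) ⁻¹' A) := by
    ext ⟨z, T⟩
    cases T <;> simp [nodeMap]
  rw [this]
  exact ((h0 hA).prod IsBox.nil.measurableSet).union (hemb.measurableSet_image.2 (h1 hA))

/-- Truncation of a tree at depth `n`. -/
def trunc {L : Type} : ℕ → BinaryTree L → BinaryTree L
  | 0, _ => .nil
  | _ + 1, .nil => .nil
  | n + 1, .node a l r => .node a (trunc n l) (trunc n r)

lemma trunc_eq_self {L : Type} {n : ℕ} {T : BinaryTree L} (h : T.height ≤ n) : trunc n T = T := by
  induction n generalizing T with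
  | zero => cases T <;> simp_all [trunc]
  | succ n ih =>
    cases T with
    | nil => rfl
    | node a l r =>
      simp only [BinaryTree.height, add_le_add_iff_right, sup_le_iff] at h
      rw [trunc, ih h.1, ih h.2]

lemma Measurable.node {a : Z → L} {l r : Z → BinaryTree L} (ha : Measurable a) (hl : Measurable l)
    (hr : Measurable r) : Measurable fun z => BinaryTree.node (a z) (l z) (r z) :=
  measurable_nodeMap.comp (ha.prodMk (hl.prodMk hr))

lemma measurable_trunc (n : ℕ) : Measurable (trunc n : BinaryTree L → BinaryTree L) := by
  induction n with
  | zero => exact measurable_const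
  | succ n ih =>
    have : Measurable fun w : Unit × BinaryTree L => trunc (n + 1) w.2 := by
      refine measurable_of_cases measurable_const ?_
      exact Measurable.node (by fun_prop) (ih.comp (by fun_prop)) (ih.comp (by fun_prop))
    exact this.comp (measurable_prodMk_left (x := ()))

/-- Measurability on all trees follows from measurability on the trees of bounded height. -/
lemma measurable_of_trunc {h : Z × BinaryTree L → Y}
    (H : ∀ n, Measurable fun w : Z × BinaryTree L => h (w.1, trunc n w.2)) : Measurable h := by
  intro A hA
  have : h ⁻¹' A = ⋃ n, ⋂ m ∈ Ici n,
      (fun w : Z × BinaryTree L => h (w.1, trunc m w.2)) ⁻¹' A := by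
    ext ⟨z, T⟩
    simp only [mem_preimage, mem_iUnion, mem_iInter, mem_Ici]
    constructor
    · intro hT
      exact ⟨T.height, fun m hm => by rwa [trunc_eq_self hm]⟩
    · rintro ⟨n, hn⟩
      have := hn (max n T.height) (le_max_left _ _)
      rwa [trunc_eq_self (le_max_right _ _)] at this
  rw [this]
  exact .iUnion fun n => .biInter (to_countable _) fun m _ => H m hA

lemma measurable_at {d : ℕ} :
    Measurable fun w : ℝ × TimedTree d => TimedTree.at w.1 w.2 := by
  refine measurable_of_trunc fun n => ?_
  induction n with
  | zero => exact measurable_const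
  | succ n ih =>
    refine measurable_of_cases measurable_const ?_
    simp only [nodeMap, trunc, TimedTree.at]
    refine Measurable.ite (measurableSet_le (by fun_prop) (by fun_prop)) ?_ measurable_const
    refine Measurable.node (by fun_prop) ?_ ?_
    · exact ih.comp (g := fun w : ℝ × TimedTree d => TimedTree.at w.1 (trunc n w.2))
        (f := fun w : ℝ × (ℝ × Cut d) × TimedTree d × TimedTree d => (w.1, w.2.2.1)) (by fun_prop)
    · exact ih.comp (g := fun w : ℝ × TimedTree d => TimedTree.at w.1 (trunc n w.2))
        (f := fun w : ℝ × (ℝ × Cut d) × TimedTree d × TimedTree d => (w.1, w.2.2.2)) (by fun_prop)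

end Trees

/-! ### Cuts that hit a block -/

section Hit

variable {d : ℕ}

lemma Cut.measurable_eval (x : EuclideanSpace ℝ (Fin d)) :
    Measurable fun c : Cut d => c.eval x := by
  have h1 : Measurable fun p : DimPair d => x p.1.1 := .of_discrete
  have h2 : Measurable fun p : DimPair d => x p.1.2 := .of_discrete
  have hfst : Measurable fun c : Cut d => c.1 := measurable_fst
  have h1' : Measurable fun c : Cut d => x c.1.1.1 := h1.comp hfst
  have h2' : Measurable fun c : Cut d => x c.1.1.2 := h2.comp hfst
  unfold Cut.eval
  exact ((h1'.mul (by fun_prop)).add (h2'.mul (by fun_prop))).sub (by fun_prop)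

lemma Cut.continuous_eval (c : Cut d) : Continuous c.eval := by
  unfold Cut.eval
  fun_prop

/-- The linear part of `Cut.eval`. -/
noncomputable def Cut.linear (c : Cut d) : EuclideanSpace ℝ (Fin d) →ₗ[ℝ] ℝ where
  toFun x := x c.1.1.1 * Real.cos c.2.1 + x c.1.1.2 * Real.sin c.2.1
  map_add' x y := by simp; ring
  map_smul' a x := by simp; ring

lemma Cut.eval_eq (c : Cut d) (x : EuclideanSpace ℝ (Fin d)) : c.eval x = c.linear x - c.2.2 := rfl

lemma Cut.neg_eq (c : Cut d) : c.neg = {x | c.linear x < c.2.2} := by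
  ext x; simp [Cut.neg, Cut.eval_eq]

lemma Cut.pos_eq (c : Cut d) : c.pos = {x | c.2.2 < c.linear x} := by
  ext x; simp [Cut.pos, Cut.eval_eq]

lemma Cut.convex_neg (c : Cut d) : Convex ℝ c.neg := by
  rw [c.neg_eq]
  exact convex_halfSpace_lt c.linear.isLinear _

lemma Cut.convex_pos (c : Cut d) : Convex ℝ c.pos := by
  rw [c.pos_eq]
  exact convex_halfSpace_gt c.linear.isLinear _

/-- The cuts whose hyperplane meets `B`. -/
def hit (B : Set (EuclideanSpace ℝ (Fin d))) : Set (Cut d) := {c | ∃ x ∈ B, c.eval x = 0}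

lemma hit_mono {B B' : Set (EuclideanSpace ℝ (Fin d))} (h : B ⊆ B') : hit B ⊆ hit B' :=
  fun _ ⟨x, hx, hc⟩ => ⟨x, h hx, hc⟩

@[simp] lemma hit_empty : hit (∅ : Set (EuclideanSpace ℝ (Fin d))) = ∅ := by simp [hit]

lemma notMem_hit_of_subset_neg {B : Set (EuclideanSpace ℝ (Fin d))} {c : Cut d} (h : B ⊆ c.neg) :
    c ∉ hit B := fun ⟨_, hx, hc⟩ => (h hx).ne hc

lemma notMem_hit_of_subset_pos {B : Set (EuclideanSpace ℝ (Fin d))} {c : Cut d} (h : B ⊆ c.pos) :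
    c ∉ hit B := fun ⟨_, hx, hc⟩ => (h hx).ne' hc

/-- By the intermediate value theorem, a hyperplane that leaves a convex set on neither of its sides
meets this set. -/
lemma mem_hit_of_not_subset {B : Set (EuclideanSpace ℝ (Fin d))} (hB : Convex ℝ B) {c : Cut d}
    (h1 : ¬B ⊆ c.neg) (h2 : ¬B ⊆ c.pos) : c ∈ hit B := by
  obtain ⟨x, hx, hx'⟩ := not_subset.1 h1
  obtain ⟨y, hy, hy'⟩ := not_subset.1 h2
  have := hB.isPreconnected.intermediate_value hy hx c.continuous_eval.continuousOn
  obtain ⟨z, hz, hz'⟩ := this ⟨not_lt.1 hy', not_lt.1 hx'⟩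
  exact ⟨z, hz, hz'⟩

end Hit

/-! ### Measurable families of blocks -/

section Family

variable {d : ℕ} {Z Y : Type} [MeasurableSpace Z] [MeasurableSpace Y]

/-- Measurability of a set-valued map: for every Carathéodory function `g`, which may depend on
further parameters, it is a measurable event that `g` is nonnegative somewhere on the set. The
further parameters make the notion stable under intersection with random half-spaces. -/
def HitMeasurable (B : Z → Set (EuclideanSpace ℝ (Fin d))) : Prop :=
  ∀ (Y : Type) [MeasurableSpace Y] (π : Y → Z) (g : Y → EuclideanSpace ℝ (Fin d) → ℝ),
    Measurable π → (∀ x, Measurable fun y => g y x) → (∀ y, Continuous (g y)) →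
      MeasurableSet {y | ∃ x ∈ B (π y), 0 ≤ g y x}

lemma HitMeasurable.comp {B : Z → Set (EuclideanSpace ℝ (Fin d))} (hB : HitMeasurable B)
    {f : Y → Z} (hf : Measurable f) : HitMeasurable fun y => B (f y) :=
  fun Y' _ π g hπ hg hg' => hB Y' (fun y => f (π y)) g (hf.comp hπ) hg hg'

lemma HitMeasurable.inter_neg {B : Z → Set (EuclideanSpace ℝ (Fin d))} (hB : HitMeasurable B)
    {h : Z → EuclideanSpace ℝ (Fin d) → ℝ} (hh : ∀ x, Measurable fun z => h z x)
    (hh' : ∀ z, Continuous (h z)) : HitMeasurable fun z => B z ∩ {x | h z x < 0} := by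
  intro Y _ π g hπ hg hg'
  have : {y | ∃ x ∈ B (π y) ∩ {x | h (π y) x < 0}, 0 ≤ g y x} =
      ⋃ n : ℕ, {y | ∃ x ∈ B (π y), 0 ≤ min (-h (π y) x - 1 / ((n : ℝ) + 1)) (g y x)} := by
    ext y
    simp only [mem_inter_iff, mem_ofPred_eq, mem_iUnion, le_min_iff]
    constructor
    · rintro ⟨x, ⟨hx, hx'⟩, hgx⟩
      obtain ⟨n, hn⟩ := exists_nat_one_div_lt (neg_pos.2 hx')
      exact ⟨n, x, hx, by linarith, hgx⟩
    · rintro ⟨n, x, hx, hx', hgx⟩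
      have : 0 < 1 / ((n : ℝ) + 1) := Nat.one_div_pos_of_nat
      exact ⟨x, ⟨hx, by linarith⟩, hgx⟩
  rw [this]
  refine .iUnion fun n => hB Y π _ hπ (fun x => ?_) (fun y => ?_)
  · exact ((((hh x).comp hπ).neg).sub_const _).min (hg x)
  · exact (((hh' _).neg).sub continuous_const).min (hg' y)

/-- On a compact set, a continuous function is nonnegative somewhere as soon as it is almost
nonnegative at the points of a countable dense subset. -/
lemma IsCompact.hitMeasurable {K : Set (EuclideanSpace ℝ (Fin d))} (hK : IsCompact K) :
    HitMeasurable fun _ : Z => K := by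
  intro Y _ π g hπ hg hg'
  obtain ⟨D, hDK, hDc, hD⟩ :=
    (TopologicalSpace.IsSeparable.of_separableSpace K).exists_countable_dense_subset
  have : {y | ∃ x ∈ K, 0 ≤ g y x} = ⋂ n : ℕ, ⋃ x ∈ D, {y | -(1 / ((n : ℝ) + 1)) < g y x} := by
    ext y
    simp only [mem_ofPred_eq, mem_iInter, mem_iUnion, exists_prop]
    constructor
    · rintro ⟨x, hx, hgx⟩ n
      have hn : -(1 / ((n : ℝ) + 1)) < g y x := by
        have : 0 < 1 / ((n : ℝ) + 1) := Nat.one_div_pos_of_nat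
        linarith
      obtain ⟨x', hx', hx''⟩ :=
        mem_closure_iff.1 (hD hx) _ (isOpen_lt continuous_const (hg' y)) hn
      exact ⟨x', hx'', hx'⟩
    · intro H
      obtain ⟨x0, hx0, -⟩ := H 0
      obtain ⟨x, hx, hmax⟩ := hK.exists_isMaxOn ⟨x0, hDK hx0⟩ (hg' y).continuousOn
      refine ⟨x, hx, ?_⟩
      by_contra! hneg
      obtain ⟨n, hn⟩ := exists_nat_one_div_lt (neg_pos.2 hneg)
      obtain ⟨x', hx', hlt⟩ := H n
      have := hmax (hDK hx')
      simp only [mem_ofPred_eq] at this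
      linarith
  rw [this]
  exact .iInter fun n => .biUnion hDc fun x _ => measurableSet_lt measurable_const (hg x)

lemma HitMeasurable.cut_neg {B : Z → Set (EuclideanSpace ℝ (Fin d))} (hB : HitMeasurable B)
    {c : Z → Cut d} (hc : Measurable c) : HitMeasurable fun z => B z ∩ (c z).neg :=
  hB.inter_neg (h := fun z x => (c z).eval x) (fun x => (Cut.measurable_eval x).comp hc)
    (fun z => (c z).continuous_eval)

lemma HitMeasurable.cut_pos {B : Z → Set (EuclideanSpace ℝ (Fin d))} (hB : HitMeasurable B)
    {c : Z → Cut d} (hc : Measurable c) : HitMeasurable fun z => B z ∩ (c z).pos := by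
  have := hB.inter_neg (h := fun z x => -(c z).eval x)
    (fun x => ((Cut.measurable_eval x).comp hc).neg) (fun z => (c z).continuous_eval.neg)
  simpa only [neg_lt_zero, Cut.pos] using this

lemma HitMeasurable.measurableSet_hit {B : Z → Set (EuclideanSpace ℝ (Fin d))}
    (hB : HitMeasurable B) : MeasurableSet {w : Z × Cut d | w.2 ∈ hit (B w.1)} := by
  have := hB (Z × Cut d) Prod.fst (fun w x => -|w.2.eval x|) measurable_fst
    (fun x => (((Cut.measurable_eval x).comp measurable_snd).abs).neg)
    (fun w => (w.2.continuous_eval.abs).neg)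
  simpa only [Left.nonneg_neg_iff, abs_nonpos_iff, hit, mem_ofPred_eq] using this

lemma HitMeasurable.measurableSet_hit_const {B : Set (EuclideanSpace ℝ (Fin d))}
    (hB : HitMeasurable fun _ : Unit => B) : MeasurableSet (hit B) :=
  measurable_prodMk_left (x := ()) hB.measurableSet_hit

lemma HitMeasurable.measurableSet_subset_neg {B : Z → Set (EuclideanSpace ℝ (Fin d))}
    (hB : HitMeasurable B) {c : Z → Cut d} (hc : Measurable c) :
    MeasurableSet {z | B z ⊆ (c z).neg} := by
  have := (hB Z id (fun z x => (c z).eval x) measurable_id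
    (fun x => (Cut.measurable_eval x).comp hc) (fun z => (c z).continuous_eval)).compl
  convert this using 1
  ext z
  simp [subset_def, Cut.neg]

lemma HitMeasurable.measurableSet_subset_pos {B : Z → Set (EuclideanSpace ℝ (Fin d))}
    (hB : HitMeasurable B) {c : Z → Cut d} (hc : Measurable c) :
    MeasurableSet {z | B z ⊆ (c z).pos} := by
  have := (hB Z id (fun z x => -(c z).eval x) measurable_id
    (fun x => ((Cut.measurable_eval x).comp hc).neg) (fun z => (c z).continuous_eval.neg)).compl
  convert this using 1
  ext z
  simp [subset_def, Cut.pos]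

end Family

/-! ### Restriction of labelled trees -/

section Restrict

variable {d : ℕ} {L Z : Type} [MeasurableSpace L] [MeasurableSpace Z]

open Classical in
/-- Restriction to `B` of a hierarchical partition whose labels `x` carry the cuts `cut x`. -/
noncomputable def restrictBy {d : ℕ} {L : Type} (cut : L → Cut d)
    (B : Set (EuclideanSpace ℝ (Fin d))) : BinaryTree L → BinaryTree L
  | .nil => .nil
  | .node a l r =>
      if B ⊆ (cut a).neg then restrictBy cut B l
      else if B ⊆ (cut a).pos then restrictBy cut B r
      else .node a (restrictBy cut (B ∩ (cut a).neg) l) (restrictBy cut (B ∩ (cut a).pos) r)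

lemma restrict_eq_restrictBy (B : Set (EuclideanSpace ℝ (Fin d))) (T : BinaryTree (Cut d)) :
    restrict B T = restrictBy id B T := by
  induction T generalizing B with
  | nil => rfl
  | node c l r hl hr =>
    simp only [restrict, restrictBy, hl, hr, id]

lemma measurable_restrictBy {cut : L → Cut d} (hcut : Measurable cut)
    {B : Z → Set (EuclideanSpace ℝ (Fin d))} (hB : HitMeasurable B) :
    Measurable fun w : Z × BinaryTree L => restrictBy cut (B w.1) w.2 := by
  refine measurable_of_trunc fun n => ?_
  induction n generalizing Z with
  | zero => exact measurable_const
  | succ n ih =>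
    refine measurable_of_cases measurable_const ?_
    simp only [nodeMap, trunc, restrictBy]
    have hB' : HitMeasurable fun w : Z × L × BinaryTree L × BinaryTree L => B w.1 :=
      hB.comp measurable_fst
    have hc : Measurable fun w : Z × L × BinaryTree L × BinaryTree L => cut w.2.1 := by fun_prop
    refine Measurable.ite (hB'.measurableSet_subset_neg hc) ?_
      (Measurable.ite (hB'.measurableSet_subset_pos hc) ?_ (Measurable.node (by fun_prop) ?_ ?_))
    · exact (ih hB').comp (f := fun w => (w, w.2.2.1)) (by fun_prop)
    · exact (ih hB').comp (f := fun w => (w, w.2.2.2)) (by fun_prop)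
    · exact (ih (hB'.cut_neg hc)).comp (f := fun w => (w, w.2.2.1)) (by fun_prop)
    · exact (ih (hB'.cut_pos hc)).comp (f := fun w => (w, w.2.2.2)) (by fun_prop)

end Restrict

/-! ### Integration over the cuts of the terminal nodes -/

section LeafInt

variable {d : ℕ} {Z : Type} [MeasurableSpace Z]

/-- The invariant measure on cutting hyperplanes, restricted to directions in `(0, π]`. -/
noncomputable def cutMeasure (d : ℕ) : Measure (Cut d) :=
  Measure.count.prod ((volume.restrict (Ioc 0 Real.pi)).prod volume)

instance : SFinite (cutMeasure d) := by unfold cutMeasure; infer_instance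

/-- The integral of `φ` over all trees obtained from `T`, a hierarchical partition of `B`, by making
at time `t` one more cut that hits its terminal node. -/
noncomputable def leafInt (B : Set (EuclideanSpace ℝ (Fin d))) (t : ℝ) (φ : TimedTree d → ℝ≥0∞)
    (T : TimedTree d) : ℝ≥0∞ :=
  ((leaves Prod.snd B T).map fun b => ∫⁻ c in hit b.1, φ (b.2 (t, c)) ∂cutMeasure d).sum

lemma leafInt_nil (B : Set (EuclideanSpace ℝ (Fin d))) (t : ℝ) (φ : TimedTree d → ℝ≥0∞) :
    leafInt B t φ .nil = ∫⁻ c in hit B, φ (.node (t, c) .nil .nil) ∂cutMeasure d := by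
  simp [leafInt, leaves]

lemma leafInt_node (B : Set (EuclideanSpace ℝ (Fin d))) (t : ℝ) (φ : TimedTree d → ℝ≥0∞)
    (a : ℝ × Cut d) (l r : TimedTree d) :
    leafInt B t φ (.node a l r) =
      leafInt (B ∩ a.2.neg) t (fun T => φ (.node a T r)) l +
        leafInt (B ∩ a.2.pos) t (fun T => φ (.node a l T)) r := by
  simp [leafInt, leaves, Function.comp_def]

lemma measurable_leafInt {B : Z → Set (EuclideanSpace ℝ (Fin d))} (hB : HitMeasurable B)
    {t : Z → ℝ} (ht : Measurable t) {φ : Z → TimedTree d → ℝ≥0∞}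
    (hφ : Measurable (Function.uncurry φ)) :
    Measurable fun w : Z × TimedTree d => leafInt (B w.1) (t w.1) (φ w.1) w.2 := by
  have hnil : ∀ {Z : Type} [MeasurableSpace Z] {B : Z → Set (EuclideanSpace ℝ (Fin d))}
      (_ : HitMeasurable B) {t : Z → ℝ} (_ : Measurable t) {φ : Z → TimedTree d → ℝ≥0∞}
      (_ : Measurable (Function.uncurry φ)),
      Measurable fun z => leafInt (B z) (t z) (φ z) .nil := by
    intro Z _ B hB t ht φ hφ
    simp only [leafInt_nil]
    have hm := hB.measurableSet_hit
    have : ∀ z, ∫⁻ c in hit (B z), φ z (.node (t z, c) .nil .nil) ∂cutMeasure d =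
        ∫⁻ c, {w : Z × Cut d | w.2 ∈ hit (B w.1)}.indicator
          (fun w => φ w.1 (.node (t w.1, w.2) .nil .nil)) (z, c) ∂cutMeasure d := by
      intro z
      have hz : MeasurableSet (hit (B z)) := measurable_prodMk_left (x := z) hm
      rw [← lintegral_indicator hz]
      rfl
    simp only [this]
    refine Measurable.lintegral_prod_right' (f := {w : Z × Cut d | w.2 ∈ hit (B w.1)}.indicator
          (fun w => φ w.1 (.node (t w.1, w.2) .nil .nil))) (Measurable.indicator ?_ hm)
    have hnode : Measurable fun w : Z × Cut d =>
        (BinaryTree.node (t w.1, w.2) .nil .nil : TimedTree d) :=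
      Measurable.node (by fun_prop) measurable_const measurable_const
    exact hφ.comp (measurable_fst.prodMk hnode)
  refine measurable_of_trunc fun n => ?_
  induction n generalizing Z with
  | zero => exact (hnil hB ht hφ).comp measurable_fst
  | succ n ih =>
    refine measurable_of_cases (hnil hB ht hφ) ?_
    simp only [nodeMap, trunc, leafInt_node]
    have hB' : HitMeasurable fun w : Z × (ℝ × Cut d) × TimedTree d × TimedTree d => B w.1 :=
      hB.comp measurable_fst
    have hc : Measurable fun w : Z × (ℝ × Cut d) × TimedTree d × TimedTree d => w.2.1.2 := by
      fun_prop
    have ht' : Measurable fun w : Z × (ℝ × Cut d) × TimedTree d × TimedTree d => t w.1 := by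
      fun_prop
    refine Measurable.add ?_ ?_
    · refine (ih (hB'.cut_neg hc) ht' (φ := fun w T => φ w.1 (.node w.2.1 T (trunc n w.2.2.2)))
        ?_).comp (f := fun w => (w, w.2.2.1)) (by fun_prop)
      refine hφ.comp ((by fun_prop : Measurable fun w : (Z × (ℝ × Cut d) × TimedTree d ×
        TimedTree d) × TimedTree d => w.1.1).prodMk
          (Measurable.node (by fun_prop) (by fun_prop) ?_))
      exact (measurable_trunc n).comp (by fun_prop)
    · refine (ih (hB'.cut_pos hc) ht' (φ := fun w T => φ w.1 (.node w.2.1 (trunc n w.2.2.1) T))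
        ?_).comp (f := fun w => (w, w.2.2.2)) (by fun_prop)
      refine hφ.comp ((by fun_prop : Measurable fun w : (Z × (ℝ × Cut d) × TimedTree d ×
        TimedTree d) × TimedTree d => w.1.1).prodMk
          (Measurable.node (by fun_prop) ?_ (by fun_prop)))
      exact (measurable_trunc n).comp (by fun_prop)

lemma measurable_of_mem_leaves {B : Set (EuclideanSpace ℝ (Fin d))} {T : TimedTree d}
    {b : Set (EuclideanSpace ℝ (Fin d)) × (ℝ × Cut d → TimedTree d)}
    (hb : b ∈ leaves Prod.snd B T) : Measurable b.2 := by
  induction T generalizing B b with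
  | nil =>
    simp only [leaves, List.mem_singleton] at hb
    subst hb
    exact Measurable.node measurable_id measurable_const measurable_const
  | node a l r hl hr =>
    simp only [leaves, List.mem_append, List.mem_map] at hb
    rcases hb with ⟨b, hb, rfl⟩ | ⟨b, hb, rfl⟩
    · exact Measurable.node measurable_const (hl hb) measurable_const
    · exact Measurable.node measurable_const measurable_const (hr hb)

end LeafInt

/-! ### The Cauchy-Crofton formula for convex polygons -/

section Crofton

/-- The linear form `x ↦ x 0 * cos θ + x 1 * sin θ`, whose image of `K` is `segment K θ`. -/
noncomputable def normalForm (θ : ℝ) : EuclideanSpace ℝ (Fin 2) →L[ℝ] ℝ :=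
  LinearMap.toContinuousLinearMap
    { toFun := fun x => x 0 * Real.cos θ + x 1 * Real.sin θ
      map_add' := fun x y => by simp; ring
      map_smul' := fun a x => by simp; ring }

lemma normalForm_apply (θ : ℝ) (x : EuclideanSpace ℝ (Fin 2)) :
    normalForm θ x = x 0 * Real.cos θ + x 1 * Real.sin θ := rfl

lemma segment_eq_image (K : Set (EuclideanSpace ℝ (Fin 2))) (θ : ℝ) :
    segment K θ = normalForm θ '' K := rfl

lemma normalForm_surjective (θ : ℝ) : Function.Surjective (normalForm θ) := by
  intro u
  refine ⟨!₂[u * Real.cos θ, u * Real.sin θ], ?_⟩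
  simp only [normalForm_apply, Matrix.cons_val_zero, Matrix.cons_val_one]
  linear_combination u * Real.cos_sq_add_sin_sq θ

lemma lintegral_abs_normalForm {v : EuclideanSpace ℝ (Fin 2)} (hv : ‖v‖ = 1) :
    ∫⁻ θ in Ioc 0 Real.pi, ENNReal.ofReal |normalForm θ v| = 2 := by
  have hv2 : v 0 ^ 2 + v 1 ^ 2 = 1 := by
    have := EuclideanSpace.real_norm_sq_eq v
    rw [hv, Fin.sum_univ_two] at this
    linarith
  obtain ⟨φ, h0, h1⟩ : ∃ φ : ℝ, v 0 = Real.cos φ ∧ v 1 = Real.sin φ := by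
    have hn : ‖(⟨v 0, v 1⟩ : ℂ)‖ = 1 := by
      rw [Complex.norm_def, Complex.normSq_mk, Real.sqrt_eq_one]
      linarith
    have hne : (⟨v 0, v 1⟩ : ℂ) ≠ 0 := by
      intro h
      simp [h] at hn
    refine ⟨Complex.arg ⟨v 0, v 1⟩, ?_, ?_⟩
    · rw [Complex.cos_arg hne, hn, div_one]
    · rw [Complex.sin_arg, hn, div_one]
  have hform : ∀ θ, normalForm θ v = Real.cos (θ - φ) := by
    intro θ
    rw [normalForm_apply, h0, h1, Real.cos_sub]
    ring
  have hint : ∫ θ in (0 : ℝ)..Real.pi, |Real.cos (θ - φ)| = 2 := by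
    rw [intervalIntegral.integral_comp_sub_right (fun θ => |Real.cos θ|)]
    have hper : Function.Periodic (fun θ => |Real.cos θ|) Real.pi := by
      intro θ
      simp [Real.cos_add_pi]
    have := hper.intervalIntegral_add_eq (0 - φ) (-(Real.pi / 2))
    rw [show 0 - φ + Real.pi = Real.pi - φ by ring,
      show -(Real.pi / 2) + Real.pi = Real.pi / 2 by ring] at this
    rw [this, intervalIntegral.integral_congr (g := Real.cos), integral_cos]
    · simp; norm_num
    · intro θ hθ
      rw [uIcc_of_le (by linarith [Real.pi_pos])] at hθ
      exact abs_of_nonneg (Real.cos_nonneg_of_mem_Icc hθ)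
  simp only [hform]
  rw [← ofReal_integral_eq_lintegral_ofReal, ← intervalIntegral.integral_of_le Real.pi_pos.le,
    hint]
  · simp
  · exact (Continuous.integrableOn_Icc (by fun_prop)).mono_set Ioc_subset_Icc_self
  · exact .of_forall fun θ => abs_nonneg _

/-- The parametrisation of the line through `q` in direction `v`. -/
noncomputable def linePath (q v : EuclideanSpace ℝ (Fin 2)) (t : ℝ) : EuclideanSpace ℝ (Fin 2) :=
  q + t • v

lemma isometry_linePath (q : EuclideanSpace ℝ (Fin 2)) {v : EuclideanSpace ℝ (Fin 2)}
    (hv : ‖v‖ = 1) : Isometry (linePath q v) := by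
  refine Isometry.of_dist_eq fun s t => ?_
  rw [linePath, linePath, dist_add_left, dist_eq_norm, ← sub_smul, norm_smul, hv, mul_one,
    dist_eq_norm]

lemma normalForm_linePath (q v : EuclideanSpace ℝ (Fin 2)) (θ t : ℝ) :
    normalForm θ (linePath q v t) = normalForm θ q + normalForm θ v * t := by
  simp [linePath, mul_comm]

lemma volume_segment_linePath (q v : EuclideanSpace ℝ (Fin 2)) (A : Set ℝ) (θ : ℝ) :
    volume (segment (linePath q v '' A) θ) = ENNReal.ofReal |normalForm θ v| * volume A := by
  have : segment (linePath q v '' A) θ =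
      (fun x => normalForm θ q + x) '' ((fun t => normalForm θ v • t) '' A) := by
    simp only [segment_eq_image, image_image, normalForm_linePath, smul_eq_mul]
  rw [this, image_add_left, measure_preimage_add, image_smul, Measure.addHaar_smul]
  simp

/-- The formula for a subset of a line, which is hit once by almost every line that it hits. -/
lemma lintegral_volume_segment_linePath (q : EuclideanSpace ℝ (Fin 2))
    {v : EuclideanSpace ℝ (Fin 2)} (hv : ‖v‖ = 1) (A : Set ℝ) :
    ∫⁻ θ in Ioc 0 Real.pi, volume (segment (linePath q v '' A) θ) =
      2 * Measure.hausdorffMeasure 1 (linePath q v '' A) := by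
  simp only [volume_segment_linePath]
  rw [lintegral_mul_const _ (by simp only [normalForm_apply]; fun_prop),
    lintegral_abs_normalForm hv,
    (isometry_linePath q hv).hausdorffMeasure_image (.inl zero_le_one), hausdorffMeasure_real]

lemma volume_image_eq_volume_image_interior {K : Set (EuclideanSpace ℝ (Fin 2))} (hK : Convex ℝ K)
    (hint : (interior K).Nonempty) {K' : Set (EuclideanSpace ℝ (Fin 2))} (h1 : interior K ⊆ K')
    (h2 : K' ⊆ closure K) (θ : ℝ) :
    volume (segment K' θ) = volume (normalForm θ '' interior K) := by
  have hconv : Convex ℝ (normalForm θ '' interior K) :=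
    hK.interior.linear_image (normalForm θ).toLinearMap
  refine le_antisymm ?_ (measure_mono (image_mono h1))
  calc volume (segment K' θ) ≤ volume (closure (normalForm θ '' interior K)) := by
        refine measure_mono ?_
        rw [segment_eq_image]
        refine (image_mono h2).trans ?_
        rw [← hK.closure_interior_eq_closure_of_nonempty_interior hint]
        exact image_closure_subset_closure_image (normalForm θ).continuous
    _ ≤ volume (normalForm θ '' interior K ∪ frontier (normalForm θ '' interior K)) := by
        refine measure_mono fun x hx => ?_
        by_cases h : x ∈ interior (normalForm θ '' interior K)
        · exact .inl (interior_subset h)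
        · exact .inr ⟨hx, h⟩
    _ ≤ volume (normalForm θ '' interior K) + 0 := by
        rw [← hconv.addHaar_frontier volume]
        exact measure_union_le _ _
    _ = _ := add_zero _

/-- A ray from an interior point of a convex body leaves it at exactly one point. -/
lemma exists_ray_frontier_iff {E : Type*} [NormedAddCommGroup E] [NormedSpace ℝ E] {C : Set E}
    (hC : Convex ℝ C) (hcl : IsClosed C) (hbd : Bornology.IsBounded C) {y w : E}
    (hy : y ∈ interior C) (hw : w ≠ 0) :
    ∃ β : ℝ, 0 < β ∧ ∀ s, 0 ≤ s → (y + s • w ∈ frontier C ↔ s = β) := by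
  have hcont : Continuous fun s : ℝ => y + s • w := by fun_prop
  have hwn : 0 < ‖w‖ := norm_pos_iff.2 hw
  have hcomp : IsCompact (Ici (0 : ℝ) ∩ (fun s : ℝ => y + s • w) ⁻¹' C) := by
    refine Metric.isCompact_of_isClosed_isBounded (isClosed_Ici.inter (hcl.preimage hcont)) ?_
    obtain ⟨R, hR⟩ := hbd.exists_norm_le
    refine (Metric.isBounded_iff_subset_closedBall 0).2 ⟨(R + ‖y‖) / ‖w‖, ?_⟩
    rintro s ⟨-, hs⟩
    rw [mem_closedBall_zero_iff, le_div_iff₀ hwn, ← norm_smul]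
    calc ‖s • w‖ = ‖(y + s • w) - y‖ := by simp
      _ ≤ ‖y + s • w‖ + ‖y‖ := norm_sub_le _ _
      _ ≤ R + ‖y‖ := by gcongr; exact hR _ hs
  have hne : (Ici (0 : ℝ) ∩ (fun s : ℝ => y + s • w) ⁻¹' C).Nonempty :=
    ⟨0, by simpa using interior_subset hy⟩
  obtain ⟨β, ⟨hβ0, hβC⟩, hβ⟩ := hcomp.exists_isGreatest hne
  -- Points of the ray just beyond an interior point of `C` are in `C`.
  have hbeyond : ∀ s : ℝ, y + s • w ∈ interior C → ∃ s' > s, y + s' • w ∈ C := by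
    intro s hs
    have hev : ∀ᶠ s' in nhdsWithin s (Ioi s), y + s' • w ∈ interior C :=
      nhdsWithin_le_nhds (hcont.continuousAt.eventually_mem (isOpen_interior.mem_nhds hs))
    obtain ⟨s', h1, h2⟩ := (hev.and self_mem_nhdsWithin).exists
    exact ⟨s', h2, interior_subset h1⟩
  have hβpos : 0 < β := by
    obtain ⟨s', h1, h2⟩ := hbeyond 0 (by simpa using hy)
    exact h1.trans_le (hβ ⟨h1.le, h2⟩)
  refine ⟨β, hβpos, fun s hs => ?_⟩
  rw [frontier, hcl.closure_eq]
  constructor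
  · rintro ⟨hsC, hsint⟩
    by_contra hne
    have hlt : s < β := lt_of_le_of_ne (hβ ⟨hs, hsC⟩) hne
    refine hsint ?_
    rcases hs.eq_or_lt with rfl | hs
    · simpa using hy
    · refine hC.openSegment_interior_self_subset_interior hy hβC ?_
      refine ⟨1 - s / β, s / β, ?_, by positivity, by ring, ?_⟩
      · rw [sub_pos, div_lt_one hβpos]; exact hlt
      · rw [smul_add, ← add_assoc, ← add_smul, smul_smul, div_mul_cancel₀ _ hβpos.ne']
        simp
  · rintro rfl
    refine ⟨hβC, fun h => ?_⟩
    obtain ⟨s', h1, h2⟩ := hbeyond _ h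
    exact absurd (hβ ⟨hβ0.trans h1.le, h2⟩) (not_le.2 h1)

/-- A line through an interior point of a planar convex body meets its frontier in exactly two
points. -/
lemma exists_two_frontier_points {C : Set (EuclideanSpace ℝ (Fin 2))} (hC : Convex ℝ C)
    (hcl : IsClosed C) (hbd : Bornology.IsBounded C) {y : EuclideanSpace ℝ (Fin 2)}
    (hy : y ∈ interior C) (θ : ℝ) :
    ∃ y₁ y₂, y₁ ≠ y₂ ∧ frontier C ∩ {x | normalForm θ x = normalForm θ y} = {y₁, y₂} := by
  set w : EuclideanSpace ℝ (Fin 2) := !₂[-Real.sin θ, Real.cos θ] with hw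
  have hw0 : w 0 = -Real.sin θ := rfl
  have hw1 : w 1 = Real.cos θ := rfl
  have hwne : w ≠ 0 := by
    intro h
    have := Real.cos_sq_add_sin_sq θ
    rw [← hw1, ← neg_eq_iff_eq_neg.2 hw0, h] at this
    simp at this
  obtain ⟨β, hβ, hβ'⟩ := exists_ray_frontier_iff hC hcl hbd hy hwne
  obtain ⟨α, hα, hα'⟩ := exists_ray_frontier_iff hC hcl hbd hy (neg_ne_zero.2 hwne)
  refine ⟨y + β • w, y + α • -w, ?_, ?_⟩
  · intro h
    have h' : (β + α) • w = 0 := by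
      have := add_left_cancel h
      rw [add_smul, this, smul_neg, neg_add_cancel]
    exact (smul_ne_zero (by positivity) hwne) h'
  · have hform : ∀ s : ℝ, normalForm θ (y + s • w) = normalForm θ y := by
      intro s
      rw [map_add, map_smul, normalForm_apply θ w, hw0, hw1]
      simp only [smul_eq_mul]
      ring
    ext x
    simp only [mem_inter_iff, mem_ofPred_eq, mem_insert_iff, mem_singleton_iff]
    constructor
    · rintro ⟨hx, hxy⟩
      obtain ⟨s, rfl⟩ : ∃ s : ℝ, x = y + s • w := by
        refine ⟨-(x 0 - y 0) * Real.sin θ + (x 1 - y 1) * Real.cos θ, ?_⟩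
        simp only [normalForm_apply] at hxy
        have hcs := Real.cos_sq_add_sin_sq θ
        ext i
        fin_cases i
        · simp only [Fin.zero_eta, PiLp.add_apply, PiLp.smul_apply, hw0, smul_eq_mul]
          linear_combination (-(x 0 - y 0)) * hcs + Real.cos θ * hxy
        · simp only [Fin.mk_one, PiLp.add_apply, PiLp.smul_apply, hw1, smul_eq_mul]
          linear_combination (-(x 1 - y 1)) * hcs + Real.sin θ * hxy
      rcases le_total 0 s with hs | hs
      · left
        rw [(hβ' s hs).1 hx]
      · right
        have : y + s • w = y + (-s) • -w := by simp
        rw [this] at hx ⊢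
        rw [(hα' (-s) (by linarith)).1 hx]
    · rintro (rfl | rfl)
      · exact ⟨(hβ' β hβ.le).2 rfl, hform β⟩
      · refine ⟨(hα' α hα.le).2 rfl, ?_⟩
        rw [smul_neg, ← neg_smul]
        exact hform _

/-- For a direction parallel to none of the lines that carry the frontier, almost every line in this
direction that meets the body meets exactly two of the pieces of the frontier, once each. -/
lemma sum_volume_segment_eq {C : Set (EuclideanSpace ℝ (Fin 2))} (hC : Convex ℝ C)
    (hcl : IsClosed C) (hbd : Bornology.IsBounded C) (hint : (interior C).Nonempty) {n : ℕ}
    {q v : Fin n → EuclideanSpace ℝ (Fin 2)} {A : Fin n → Set ℝ}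
    (hA : ∀ i, MeasurableSet (A i))
    (hdisj : Pairwise (Function.onFun Disjoint fun i => linePath (q i) (v i) '' A i))
    (hcov : ⋃ i, linePath (q i) (v i) '' A i = frontier C) {θ : ℝ}
    (hθ : ∀ i, normalForm θ (v i) ≠ 0) :
    ∑ i, volume (segment (linePath (q i) (v i) '' A i) θ) = 2 * volume (segment C θ) := by
  classical
  set G : Set ℝ := normalForm θ '' interior C with hG
  have hGopen : IsOpen G := (normalForm θ).isOpenMap (normalForm_surjective θ) _ isOpen_interior
  set S : Fin n → Set ℝ := fun i => segment (linePath (q i) (v i) '' A i) θ with hS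
  have hSC : ∀ i, S i ⊆ segment C θ := fun i => image_mono
    ((subset_iUnion _ i).trans (hcov.le.trans hcl.frontier_subset))
  have hSmeas : ∀ i, MeasurableSet (S i) := by
    intro i
    have : S i = (fun t => normalForm θ (q i) + normalForm θ (v i) * t) '' A i := by
      simp only [hS, segment_eq_image, image_image, normalForm_linePath]
    rw [this]
    exact (((Homeomorph.mulLeft₀ _ (hθ i)).trans
      (Homeomorph.addLeft (normalForm θ (q i)))).measurableEmbedding.measurableSet_image).2 (hA i)
  have hvol : volume (segment C θ) = volume G :=
    volume_image_eq_volume_image_interior hC hint interior_subset subset_closure θ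
  have hGC : G ⊆ segment C θ := image_mono interior_subset
  have hnull : volume (segment C θ \ G) = 0 := by
    rw [measure_sdiff hGC hGopen.nullMeasurableSet, hvol, tsub_self]
    rw [hG]
    obtain ⟨R, hR⟩ :=
      ((normalForm θ).lipschitz.isBounded_image (hbd.subset interior_subset)).exists_norm_le
    refine ne_top_of_le_ne_top (measure_Icc_lt_top (a := -R) (b := R)).ne (measure_mono ?_)
    intro u hu
    exact abs_le.1 (hR u hu)
  have hSG : ∀ i, volume (S i) = ∫⁻ u in G, (S i).indicator 1 u := by
    intro i
    rw [lintegral_indicator_one (hSmeas i), Measure.restrict_apply (hSmeas i)]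
    refine le_antisymm ?_ (measure_mono inter_subset_left)
    calc volume (S i) ≤ volume ((S i ∩ G) ∪ (segment C θ \ G)) := by
          refine measure_mono fun u hu => ?_
          by_cases h : u ∈ G
          · exact .inl ⟨hu, h⟩
          · exact .inr ⟨hSC i hu, h⟩
      _ ≤ volume (S i ∩ G) + volume (segment C θ \ G) := measure_union_le _ _
      _ = volume (S i ∩ G) := by rw [hnull, add_zero]
  have hcount : ∀ u ∈ G, ∑ i, (S i).indicator (1 : ℝ → ℝ≥0∞) u = 2 := by
    rintro _ ⟨y, hy, rfl⟩
    obtain ⟨y₁, y₂, hne, h12⟩ := exists_two_frontier_points hC hcl hbd hy θ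
    have hy₁ : y₁ ∈ frontier C ∩ {x | normalForm θ x = normalForm θ y} := by simp [h12]
    have hy₂ : y₂ ∈ frontier C ∩ {x | normalForm θ x = normalForm θ y} := by simp [h12]
    obtain ⟨i₁, hi₁⟩ := mem_iUnion.1 (hcov.ge hy₁.1)
    obtain ⟨i₂, hi₂⟩ := mem_iUnion.1 (hcov.ge hy₂.1)
    have hi : i₁ ≠ i₂ := by
      rintro rfl
      obtain ⟨t₁, -, rfl⟩ := hi₁
      obtain ⟨t₂, -, rfl⟩ := hi₂
      have h := hy₁.2.trans hy₂.2.symm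
      simp only [normalForm_linePath, add_right_inj] at h
      exact hne (by rw [mul_left_cancel₀ (hθ i₁) h])
    have hmem : ∀ i, normalForm θ y ∈ S i ↔ i = i₁ ∨ i = i₂ := by
      intro i
      constructor
      · rintro ⟨x, hx, hxy⟩
        have hx12 : x ∈ ({y₁, y₂} : Set (EuclideanSpace ℝ (Fin 2))) :=
          h12.le ⟨hcov.le (mem_iUnion.2 ⟨i, hx⟩), hxy⟩
        rcases hx12 with rfl | rfl
        · exact .inl (by_contra fun h => disjoint_left.1 (hdisj h) hx hi₁)
        · exact .inr (by_contra fun h => disjoint_left.1 (hdisj h) hx hi₂)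
      · rintro (rfl | rfl)
        · exact ⟨y₁, hi₁, hy₁.2⟩
        · exact ⟨y₂, hi₂, hy₂.2⟩
    have : ∀ i, (S i).indicator (1 : ℝ → ℝ≥0∞) (normalForm θ y) =
        if i ∈ ({i₁, i₂} : Finset (Fin n)) then 1 else 0 := by
      intro i
      simp only [indicator_apply, hmem, Finset.mem_insert, Finset.mem_singleton, Pi.one_apply]
    simp only [this, Finset.sum_ite_mem, Finset.univ_inter, Finset.sum_const, Finset.card_pair hi]
    simp
  calc ∑ i, volume (S i) = ∫⁻ u in G, ∑ i, (S i).indicator 1 u := by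
        rw [lintegral_finsetSum _ fun i _ => measurable_one.indicator (hSmeas i)]
        exact Finset.sum_congr rfl fun i _ => hSG i
    _ = ∫⁻ u in G, 2 := setLIntegral_congr_fun hGopen.measurableSet hcount
    _ = 2 * volume (segment C θ) := by rw [setLIntegral_const, hvol]

lemma ae_normalForm_ne_zero {v : EuclideanSpace ℝ (Fin 2)} (hv : v ≠ 0) :
    ∀ᵐ θ ∂volume.restrict (Ioc 0 Real.pi), normalForm θ v ≠ 0 := by
  have hsub : ({θ | normalForm θ v = 0} ∩ Ioc 0 Real.pi).Subsingleton := by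
    rintro s ⟨hs, hs'⟩ t ⟨ht, ht'⟩
    simp only [mem_ofPred_eq, normalForm_apply] at hs ht
    have h0 : v 0 * Real.sin (s - t) = 0 := by
      rw [Real.sin_sub]
      linear_combination (-Real.sin t) * hs + Real.sin s * ht
    have h1 : v 1 * Real.sin (s - t) = 0 := by
      rw [Real.sin_sub]
      linear_combination (Real.cos t) * hs - Real.cos s * ht
    have hsin : Real.sin (s - t) = 0 := by
      by_contra hne
      refine hv ?_
      ext i
      fin_cases i
      · simpa [hne] using h0
      · simpa [hne] using h1
    have := (Real.sin_eq_zero_iff_of_lt_of_lt (by linarith [hs'.1, ht'.2])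
      (by linarith [ht'.1, hs'.2])).1 hsin
    linarith
  rw [ae_restrict_iff' measurableSet_Ioc]
  have hnull := hsub.measure_zero volume
  refine measure_mono_null ?_ hnull
  intro θ hθ
  simp only [mem_compl_iff, mem_ofPred_eq, Classical.not_imp, not_not] at hθ
  exact ⟨hθ.2, hθ.1⟩

/-- The Cauchy-Crofton formula for a convex body whose frontier lies on finitely many lines. -/
lemma perimeter_eq_lintegral_of_subset_lines {C : Set (EuclideanSpace ℝ (Fin 2))}
    (hC : Convex ℝ C) (hcl : IsClosed C) (hbd : Bornology.IsBounded C)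
    (hint : (interior C).Nonempty) {n : ℕ} {q v : Fin n → EuclideanSpace ℝ (Fin 2)}
    (hv : ∀ i, ‖v i‖ = 1) (hcov : frontier C ⊆ ⋃ i, range (linePath (q i) (v i))) :
    perimeter C = ∫⁻ θ in Ioc 0 Real.pi, volume (segment C θ) := by
  have hcont : ∀ i, Continuous (linePath (q i) (v i)) :=
    fun i => (isometry_linePath (q i) (hv i)).continuous
  have hrange : ∀ i, IsClosed (range (linePath (q i) (v i))) :=
    fun i => (isometry_linePath (q i) (hv i)).isClosedEmbedding.isClosed_range
  -- The part of the frontier that lies on the line `i` but on no line of smaller index.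
  set D : Fin n → Set (EuclideanSpace ℝ (Fin 2)) :=
    fun i => (frontier C ∩ range (linePath (q i) (v i))) \ ⋃ j < i, range (linePath (q j) (v j))
    with hD
  have hDmeas : ∀ i, MeasurableSet (D i) := fun i =>
    (isClosed_frontier.inter (hrange i)).measurableSet.diff
      (.iUnion fun j => .iUnion fun _ => (hrange j).measurableSet)
  have himage : ∀ i, linePath (q i) (v i) '' (linePath (q i) (v i) ⁻¹' D i) = D i := fun i =>
    image_preimage_eq_of_subset (sdiff_subset.trans inter_subset_right)
  have hdisj : Pairwise (Function.onFun Disjoint D) := by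
    have : ∀ i j, i < j → Disjoint (D i) (D j) := by
      intro i j hij
      refine disjoint_left.2 fun x hx hx' => hx'.2 ?_
      exact mem_iUnion₂.2 ⟨i, hij, hx.1.2⟩
    intro i j hij
    rcases lt_or_gt_of_ne hij with h | h
    · exact this i j h
    · exact (this j i h).symm
  have hunion : ⋃ i, D i = frontier C := by
    refine subset_antisymm (iUnion_subset fun i x hx => hx.1.1) fun x hx => ?_
    have hex : ∃ i, x ∈ range (linePath (q i) (v i)) := mem_iUnion.1 (hcov hx)
    have hwf := (wellFounded_lt (α := Fin n))
    set i := hwf.min {i | x ∈ range (linePath (q i) (v i))} hex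
    refine mem_iUnion.2 ⟨i, ⟨hx, hwf.min_mem _ hex⟩, ?_⟩
    intro h
    obtain ⟨j, hj, hxj⟩ := mem_iUnion₂.1 h
    exact hwf.not_lt_min _ hxj hj
  have hae : ∀ᵐ θ ∂volume.restrict (Ioc 0 Real.pi),
      ∑ i, volume (segment (D i) θ) = 2 * volume (segment C θ) := by
    have : ∀ᵐ θ ∂volume.restrict (Ioc 0 Real.pi), ∀ i, normalForm θ (v i) ≠ 0 :=
      ae_all_iff.2 fun i => ae_normalForm_ne_zero (by
        intro h
        have := hv i
        simp [h] at this)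
    filter_upwards [this] with θ hθ
    have := sum_volume_segment_eq hC hcl hbd hint (q := q) (v := v)
      (A := fun i => linePath (q i) (v i) ⁻¹' D i) (fun i => (hcont i).measurable (hDmeas i))
      (by simpa only [himage] using hdisj) (by simpa only [himage] using hunion) hθ
    simpa only [himage] using this
  have hone : ∀ i, ∫⁻ θ in Ioc 0 Real.pi, volume (segment (D i) θ) =
      2 * Measure.hausdorffMeasure 1 (D i) := by
    intro i
    have := lintegral_volume_segment_linePath (q i) (hv i) (linePath (q i) (v i) ⁻¹' D i)
    rwa [himage] at this
  have hsegmeas : ∀ i, Measurable fun θ => volume (segment (D i) θ) := by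
    intro i
    rw [← himage i]
    simp only [volume_segment_linePath, normalForm_apply]
    fun_prop
  have key : 2 * perimeter C = 2 * ∫⁻ θ in Ioc 0 Real.pi, volume (segment C θ) := by
    calc 2 * perimeter C = ∑ i, 2 * Measure.hausdorffMeasure 1 (D i) := by
          rw [perimeter, ← hunion, measure_iUnion hdisj hDmeas, tsum_fintype, Finset.mul_sum]
      _ = ∫⁻ θ in Ioc 0 Real.pi, ∑ i, volume (segment (D i) θ) := by
          rw [lintegral_finsetSum _ fun i _ => hsegmeas i]
          exact Finset.sum_congr rfl fun i _ => (hone i).symm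
      _ = ∫⁻ θ in Ioc 0 Real.pi, 2 * volume (segment C θ) := lintegral_congr_ae hae
      _ = _ := lintegral_const_mul' _ _ (by simp)
  exact (ENNReal.mul_right_inj (by simp) (by simp)).1 key

/-- Two planar vectors in the kernel of a nonzero linear form are parallel. -/
lemma exists_eq_smul_of_form_eq_zero {f : EuclideanSpace ℝ (Fin 2) →L[ℝ] ℝ} (hf : f ≠ 0)
    {x y : EuclideanSpace ℝ (Fin 2)} (hx : f x = 0) (hy : f y = 0) (hy0 : y ≠ 0) :
    ∃ s : ℝ, x = s • y := by
  set e : Fin 2 → EuclideanSpace ℝ (Fin 2) := fun i => EuclideanSpace.single i 1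
  have hexp : ∀ z : EuclideanSpace ℝ (Fin 2), f z = z 0 * f (e 0) + z 1 * f (e 1) := by
    intro z
    have : z = z 0 • e 0 + z 1 • e 1 := by
      ext i
      fin_cases i <;> simp [e]
    conv_lhs => rw [this]
    simp
  rw [hexp] at hx hy
  have hdet : x 0 * y 1 = x 1 * y 0 := by
    by_contra hne
    have h0 : f (e 0) = 0 := by
      have : (x 0 * y 1 - x 1 * y 0) * f (e 0) = 0 := by linear_combination y 1 * hx - x 1 * hy
      exact (mul_eq_zero.1 this).resolve_left (sub_ne_zero.2 hne)
    have h1 : f (e 1) = 0 := by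
      have : (x 0 * y 1 - x 1 * y 0) * f (e 1) = 0 := by linear_combination x 0 * hy - y 0 * hx
      exact (mul_eq_zero.1 this).resolve_left (sub_ne_zero.2 hne)
    refine hf (ContinuousLinearMap.ext fun z => ?_)
    rw [hexp, h0, h1]
    simp
  by_cases h : y 0 = 0
  · have h1 : y 1 ≠ 0 := by
      intro h1
      refine hy0 ?_
      ext i
      fin_cases i <;> simpa
    refine ⟨x 1 / y 1, ?_⟩
    ext i
    fin_cases i
    · have : x 0 = 0 := by
        have : x 0 * y 1 = 0 := by rw [hdet, h, mul_zero]
        exact (mul_eq_zero.1 this).resolve_right h1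
      simp [h, this]
    · simp [h1]
  · refine ⟨x 0 / y 0, ?_⟩
    ext i
    fin_cases i
    · simp [h]
    · simp only [Fin.mk_one, PiLp.smul_apply, smul_eq_mul]
      field_simp
      linarith

/-- A supporting line of a convex polygon at a boundary point passes through two vertices, unless
the point is itself a vertex. -/
lemma exists_line_of_mem_frontier {F : Finset (EuclideanSpace ℝ (Fin 2))}
    (hint : (interior (convexHull ℝ (F : Set (EuclideanSpace ℝ (Fin 2))))).Nonempty)
    {x : EuclideanSpace ℝ (Fin 2)}
    (hx : x ∈ frontier (convexHull ℝ (F : Set (EuclideanSpace ℝ (Fin 2))))) :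
    ∃ y ∈ F, ∃ z ∈ F, y ≠ z ∧ ∃ s : ℝ, x = y + s • (z - y) := by
  set C := convexHull ℝ (F : Set (EuclideanSpace ℝ (Fin 2))) with hC
  have hconv : Convex ℝ C := convex_convexHull ℝ _
  have hcl : IsClosed C := F.finite_toSet.isClosed_convexHull ℝ
  rw [frontier, hcl.closure_eq] at hx
  obtain ⟨f, hf⟩ := geometric_hahn_banach_open_point hconv.interior isOpen_interior hx.2
  obtain ⟨a, ha⟩ := hint
  have hf0 : f ≠ 0 := by
    rintro rfl
    simpa using hf a ha
  have hle : ∀ y ∈ C, f y ≤ f x := by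
    have hsub : C ⊆ closure (interior C) := by
      rw [hconv.closure_interior_eq_closure_of_nonempty_interior ⟨a, ha⟩]
      exact subset_closure
    intro y hy
    exact closure_minimal (fun z hz => (hf z hz).le) (isClosed_le f.continuous continuous_const)
      (hsub hy)
  obtain ⟨w, hw0, hw1, hwx⟩ := Finset.mem_convexHull'.1 hx.1
  have hzero : ∀ y ∈ F, w y * (f x - f y) = 0 := by
    refine (Finset.sum_eq_zero_iff_of_nonneg fun y hy =>
      mul_nonneg (hw0 y hy) (sub_nonneg.2 (hle y (subset_convexHull ℝ _ hy)))).1 ?_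
    have h1 : f x = ∑ y ∈ F, w y * f y := by
      conv_lhs => rw [← hwx]
      simp
    simp only [mul_sub, Finset.sum_sub_distrib, ← Finset.sum_mul, hw1, one_mul, ← h1, sub_self]
  obtain ⟨y, hy, hwy⟩ : ∃ y ∈ F, w y ≠ 0 := by
    by_contra! h
    rw [Finset.sum_eq_zero h] at hw1
    exact zero_ne_one hw1
  have hface : ∀ y ∈ F, w y ≠ 0 → f y = f x := fun y hy hwy =>
    (sub_eq_zero.1 ((mul_eq_zero.1 (hzero y hy)).resolve_left hwy)).symm
  by_cases hex : ∃ z ∈ F, w z ≠ 0 ∧ y ≠ z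
  · obtain ⟨z, hz, hwz, hyz⟩ := hex
    obtain ⟨s, hs⟩ := exists_eq_smul_of_form_eq_zero hf0 (x := x - y) (y := z - y)
      (by rw [map_sub, hface y hy hwy, sub_self])
      (by rw [map_sub, hface y hy hwy, hface z hz hwz, sub_self]) (sub_ne_zero.2 hyz.symm)
    exact ⟨y, hy, z, hz, hyz, s, by rw [← hs]; abel⟩
  · push Not at hex
    have hxy : x = y := by
      have hz : ∀ z ∈ F, z ≠ y → w z = 0 := fun z hz hzy => by
        by_contra h
        exact hzy (hex z hz h).symm
      rw [← hwx, Finset.sum_eq_single_of_mem y hy fun z hz' hzy => by rw [hz z hz' hzy, zero_smul]]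
      rw [Finset.sum_eq_single_of_mem y hy fun z hz' hzy => hz z hz' hzy] at hw1
      rw [hw1, one_smul]
    -- The polygon has another vertex, as it is not reduced to a point.
    obtain ⟨z, hz, hyz⟩ : ∃ z ∈ F, y ≠ z := by
      by_contra! h
      have hsub : C ⊆ {y} := by
        refine convexHull_min (fun z hz => ?_) (convex_singleton y)
        exact (h z hz).symm
      exact hx.2 (by
        have hay : a = y := hsub (interior_subset ha)
        rw [hxy, ← hay]
        exact ha)
    exact ⟨y, hy, z, hz, hyz, 0, by simp [hxy]⟩

lemma perimeter_convexHull (F : Finset (EuclideanSpace ℝ (Fin 2)))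
    (hint : (interior (convexHull ℝ (F : Set (EuclideanSpace ℝ (Fin 2))))).Nonempty) :
    perimeter (convexHull ℝ (F : Set (EuclideanSpace ℝ (Fin 2)))) =
      ∫⁻ θ in Ioc 0 Real.pi,
        volume (segment (convexHull ℝ (F : Set (EuclideanSpace ℝ (Fin 2)))) θ) := by
  classical
  have hcomp := F.finite_toSet.isCompact_convexHull ℝ
  set I := F.offDiag.equivFin
  refine perimeter_eq_lintegral_of_subset_lines (n := F.offDiag.card) (convex_convexHull ℝ _)
    hcomp.isClosed hcomp.isBounded hint (q := fun i => (I.symm i).1.1)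
    (v := fun i => ‖(I.symm i).1.2 - (I.symm i).1.1‖⁻¹ • ((I.symm i).1.2 - (I.symm i).1.1))
    (fun i => ?_) (fun x hx => ?_)
  · have hne := (Finset.mem_offDiag.1 (I.symm i).2).2.2
    rw [norm_smul, norm_inv, norm_norm, inv_mul_cancel₀]
    exact norm_ne_zero_iff.2 (sub_ne_zero.2 hne.symm)
  · obtain ⟨y, hy, z, hz, hyz, s, rfl⟩ := exists_line_of_mem_frontier hint hx
    refine mem_iUnion.2 ⟨I ⟨(y, z), Finset.mem_offDiag.2 ⟨hy, hz, hyz⟩⟩, s * ‖z - y‖, ?_⟩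
    simp only [Equiv.symm_apply_apply, linePath]
    rw [smul_smul, mul_assoc, mul_inv_cancel₀, mul_one]
    exact norm_ne_zero_iff.2 (sub_ne_zero.2 hyz.symm)

lemma perimeter_eq_lintegral {K : Set (EuclideanSpace ℝ (Fin 2))} (hK : Convex ℝ K)
    (hint : (interior K).Nonempty) {F : Finset (EuclideanSpace ℝ (Fin 2))}
    (hF : closure K = convexHull ℝ (F : Set (EuclideanSpace ℝ (Fin 2)))) :
    perimeter K = ∫⁻ θ in Ioc 0 Real.pi, volume (segment K θ) := by
  have hint' := hK.interior_closure_eq_interior_of_nonempty_interior hint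
  have h1 : perimeter K = perimeter (closure K) := by
    rw [perimeter, perimeter, frontier, frontier, closure_closure, hint']
  rw [h1, hF, perimeter_convexHull F (by rwa [← hF, hint'])]
  refine lintegral_congr fun θ => ?_
  rw [← hF, volume_image_eq_volume_image_interior hK hint interior_subset subset_closure,
    volume_image_eq_volume_image_interior hK hint (interior_subset.trans subset_closure) le_rfl]

end Crofton

/-! ### Polytopes as convex hulls -/

section Polytope

variable {d : ℕ}

/-- Two extreme points of an intersection of half-spaces which lie on the same of its bounding
hyperplanes are equal: one could move from each in the direction of the other and backwards. -/
lemma finite_extremePoints (H : Finset (EuclideanSpace ℝ (Fin d) × ℝ)) :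
    (extremePoints ℝ {x : EuclideanSpace ℝ (Fin d) | ∀ h ∈ H, inner ℝ h.1 x ≤ h.2}).Finite := by
  classical
  set P := {x : EuclideanSpace ℝ (Fin d) | ∀ h ∈ H, inner ℝ h.1 x ≤ h.2}
  refine Finite.of_finite_image (f := fun x => H.filter fun h => inner ℝ h.1 x = h.2)
    (H.powerset.finite_toSet.subset ?_) ?_
  · rintro _ ⟨x, -, rfl⟩
    exact Finset.mem_coe.2 (Finset.mem_powerset.2 (Finset.filter_subset _ _))
  · intro x hx y hy hxy
    have hact : ∀ h ∈ H, inner ℝ h.1 x = h.2 → inner ℝ h.1 (y - x) = 0 := by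
      intro h hh hhx
      have : h ∈ H.filter fun h => inner ℝ h.1 y = h.2 := by
        exact (Finset.ext_iff.1 hxy h).1 (Finset.mem_filter.2 ⟨hh, hhx⟩)
      rw [inner_sub_right, hhx, (Finset.mem_filter.1 this).2, sub_self]
    have hev : ∀ᶠ ε in nhds (0 : ℝ), ∀ h ∈ H, inner ℝ h.1 (x + ε • (y - x)) ≤ h.2 := by
      refine (Filter.eventually_all_finset H).2 fun h hh => ?_
      rcases eq_or_lt_of_le (hx.1 h hh) with heq | hlt
      · refine .of_forall fun ε => ?_
        rw [inner_add_right, inner_smul_right, hact h hh heq, mul_zero, add_zero, heq]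
      · have hcont : Continuous fun ε : ℝ => inner ℝ h.1 (x + ε • (y - x)) := by fun_prop
        have := (hcont.continuousAt (x := 0)).eventually_lt (continuousAt_const (y := h.2))
          (by simpa using hlt)
        exact this.mono fun ε hε => hε.le
    obtain ⟨δ, hδ, hball⟩ := Metric.eventually_nhds_iff.1 hev
    have hmem : ∀ ε : ℝ, |ε| < δ → x + ε • (y - x) ∈ P := fun ε hε h hh =>
      hball (by simpa using hε) h hh
    have h1 := hmem (δ / 2) (by rw [abs_of_pos (by positivity)]; linarith)
    have h2 := hmem (-(δ / 2)) (by rw [abs_neg, abs_of_pos (by positivity)]; linarith)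
    have hseg : x ∈ openSegment ℝ (x + (δ / 2) • (y - x)) (x + (-(δ / 2)) • (y - x)) :=
      ⟨1 / 2, 1 / 2, by norm_num, by norm_num, by norm_num, by module⟩
    have := hx.2 h1 h2 hseg
    have h0 : (δ / 2) • (y - x) = 0 := by simpa using this
    have : y - x = 0 := (smul_eq_zero.1 h0).resolve_left (by positivity)
    exact (sub_eq_zero.1 this).symm

lemma isClosed_polytope (H : Finset (EuclideanSpace ℝ (Fin d) × ℝ)) :
    IsClosed {x : EuclideanSpace ℝ (Fin d) | ∀ h ∈ H, inner ℝ h.1 x ≤ h.2} := by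
  have : {x : EuclideanSpace ℝ (Fin d) | ∀ h ∈ H, inner ℝ h.1 x ≤ h.2} =
      ⋂ h ∈ H, {x | inner ℝ h.1 x ≤ h.2} := by
    ext x
    simp
  rw [this]
  exact isClosed_biInter fun h _ => isClosed_le (by fun_prop) continuous_const

lemma convex_polytope (H : Finset (EuclideanSpace ℝ (Fin d) × ℝ)) :
    Convex ℝ {x : EuclideanSpace ℝ (Fin d) | ∀ h ∈ H, inner ℝ h.1 x ≤ h.2} := by
  have : {x : EuclideanSpace ℝ (Fin d) | ∀ h ∈ H, inner ℝ h.1 x ≤ h.2} =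
      ⋂ h ∈ H, {x | inner ℝ h.1 x ≤ h.2} := by
    ext x
    simp
  rw [this]
  exact convex_iInter₂ fun h _ => convex_halfSpace_le (innerSL ℝ h.1).isLinear _

/-- The extreme points of a polytope form a finite set whose convex hull is the polytope. -/
lemma exists_eq_convexHull {H : Finset (EuclideanSpace ℝ (Fin d) × ℝ)}
    (hbd : Bornology.IsBounded {x : EuclideanSpace ℝ (Fin d) | ∀ h ∈ H, inner ℝ h.1 x ≤ h.2}) :
    ∃ F : Finset (EuclideanSpace ℝ (Fin d)),
      {x : EuclideanSpace ℝ (Fin d) | ∀ h ∈ H, inner ℝ h.1 x ≤ h.2} =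
        convexHull ℝ (F : Set (EuclideanSpace ℝ (Fin d))) := by
  have hfin := finite_extremePoints H
  refine ⟨hfin.toFinset, ?_⟩
  rw [hfin.coe_toFinset]
  have := closure_convexHull_extremePoints
    (Metric.isCompact_of_isClosed_isBounded (isClosed_polytope H) hbd) (convex_polytope H)
  rw [(hfin.isClosed_convexHull ℝ).closure_eq] at this
  exact this.symm

end Polytope

/-! ### The blocks of a hierarchical partition -/

section Block

variable {d : ℕ}

/-- The properties shared by the nonempty blocks of the hierarchical partitions of a convex
polyhedron, which are not closed in general but have a polytope as closure. -/
structure IsBlock (B : Set (EuclideanSpace ℝ (Fin d))) : Prop where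
  convex : Convex ℝ B
  isBounded : Bornology.IsBounded B
  nonempty_interior : (interior B).Nonempty
  exists_closure_eq : ∃ H : Finset (EuclideanSpace ℝ (Fin d) × ℝ),
    closure B = {x | ∀ h ∈ H, inner ℝ h.1 x ≤ h.2}
  hitMeasurable : HitMeasurable fun _ : Unit => B

lemma IsConvexPolyhedron.isCompact {P : Set (EuclideanSpace ℝ (Fin d))}
    (hP : IsConvexPolyhedron P) : IsCompact P := by
  obtain ⟨⟨H, rfl⟩, hbd, -⟩ := hP
  exact Metric.isCompact_of_isClosed_isBounded (isClosed_polytope H) hbd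

lemma IsConvexPolyhedron.isBlock {P : Set (EuclideanSpace ℝ (Fin d))}
    (hP : IsConvexPolyhedron P) : IsBlock P := by
  have hcomp := hP.isCompact
  obtain ⟨⟨H, hH⟩, hbd, hint⟩ := hP
  refine ⟨?_, hbd, hint, ⟨H, ?_⟩, IsCompact.hitMeasurable hcomp⟩
  · rw [hH]
    exact convex_polytope H
  · rw [hcomp.isClosed.closure_eq, hH]

lemma IsBlock.nonempty {B : Set (EuclideanSpace ℝ (Fin d))} (hB : IsBlock B) : B.Nonempty :=
  hB.nonempty_interior.mono interior_subset

lemma IsBlock.inter_halfSpace {B : Set (EuclideanSpace ℝ (Fin d))} (hB : IsBlock B)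
    {a : EuclideanSpace ℝ (Fin d)} {u : ℝ} (hne : (B ∩ {x | inner ℝ a x < u}).Nonempty) :
    IsBlock (B ∩ {x | inner ℝ a x < u}) := by
  classical
  have hopen : IsOpen {x : EuclideanSpace ℝ (Fin d) | inner ℝ a x < u} :=
    isOpen_lt (by fun_prop) continuous_const
  have hcl := hB.convex.closure_interior_eq_closure_of_nonempty_interior hB.nonempty_interior
  obtain ⟨y, hy, hyu⟩ : (interior B ∩ {x | inner ℝ a x < u}).Nonempty := by
    obtain ⟨x, hx, hxu⟩ := hne
    have : x ∈ closure (interior B) := hcl ▸ subset_closure hx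
    obtain ⟨y, hyu, hy⟩ := mem_closure_iff.1 this _ hopen hxu
    exact ⟨y, hy, hyu⟩
  refine ⟨hB.convex.inter (convex_halfSpace_lt (innerSL ℝ a).isLinear u),
    hB.isBounded.subset inter_subset_left, ?_, ?_, ?_⟩
  · rw [interior_inter, hopen.interior_eq]
    exact ⟨y, hy, hyu⟩
  · obtain ⟨H, hH⟩ := hB.exists_closure_eq
    refine ⟨insert (a, u) H, ?_⟩
    have hset : {x : EuclideanSpace ℝ (Fin d) | ∀ h ∈ insert (a, u) H, inner ℝ h.1 x ≤ h.2} =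
        closure B ∩ {x | inner ℝ a x ≤ u} := by
      ext x
      simp only [Finset.forall_mem_insert, hH, mem_inter_iff, mem_ofPred_eq]
      exact and_comm
    rw [hset]
    refine subset_antisymm (closure_minimal ?_ ?_) ?_
    · refine inter_subset_inter subset_closure fun x hx => ?_
      simp only [mem_ofPred_eq] at hx ⊢
      exact hx.le
    · exact isClosed_closure.inter (isClosed_le (by fun_prop) continuous_const)
    · -- Move from a point of the closed set towards an interior point strictly inside.
      rintro x ⟨hx, hxu⟩
      have hcont : Continuous fun t : ℝ => x + t • (y - x) := by fun_prop
      have hmem : ∀ t ∈ Ioo (0 : ℝ) 1, x + t • (y - x) ∈ B ∩ {x | inner ℝ a x < u} := by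
        rintro t ⟨h0, h1⟩
        refine ⟨interior_subset
          (hB.convex.add_smul_sub_mem_interior' hx hy ⟨h0, h1.le⟩), ?_⟩
        simp only [mem_ofPred_eq] at hxu hyu ⊢
        rw [inner_add_right, inner_smul_right, inner_sub_right]
        nlinarith
      have h0 : (0 : ℝ) ∈ closure (Ioo (0 : ℝ) 1) := by
        rw [closure_Ioo zero_ne_one]
        simp
      have := map_mem_closure hcont h0 hmem
      simpa using this
  · exact hB.hitMeasurable.inter_neg (h := fun _ x => inner ℝ a x - u) (by fun_prop) (by fun_prop)
      |> fun h => by simpa only [sub_neg] using h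

/-- The normal vector of a cutting hyperplane. -/
noncomputable def Cut.normal (c : Cut d) : EuclideanSpace ℝ (Fin d) :=
  EuclideanSpace.single c.1.1.1 (Real.cos c.2.1) + EuclideanSpace.single c.1.1.2 (Real.sin c.2.1)

lemma Cut.inner_normal (c : Cut d) (x : EuclideanSpace ℝ (Fin d)) :
    inner ℝ c.normal x = c.eval x + c.2.2 := by
  simp only [Cut.normal, inner_add_left, EuclideanSpace.inner_single_left, Cut.eval, conj_trivial]
  ring

lemma Cut.eval_add_smul_normal (c : Cut d) (x : EuclideanSpace ℝ (Fin d)) (t : ℝ) :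
    c.eval (x + t • c.normal) = c.eval x + t := by
  have hne : c.1.1.1 ≠ c.1.1.2 := c.1.2.ne
  simp only [Cut.eval, Cut.normal, PiLp.add_apply, PiLp.smul_apply, PiLp.single_apply,
    smul_eq_mul, hne, hne.symm, if_true, if_false]
  linear_combination t * Real.cos_sq_add_sin_sq c.2.1

lemma IsBlock.inter_neg {B : Set (EuclideanSpace ℝ (Fin d))} (hB : IsBlock B) {c : Cut d}
    (hne : (B ∩ c.neg).Nonempty) : IsBlock (B ∩ c.neg) := by
  have : c.neg = {x | inner ℝ c.normal x < c.2.2} := by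
    ext x
    simp [Cut.neg, c.inner_normal]
  rw [this] at hne ⊢
  exact hB.inter_halfSpace hne

lemma IsBlock.inter_pos {B : Set (EuclideanSpace ℝ (Fin d))} (hB : IsBlock B) {c : Cut d}
    (hne : (B ∩ c.pos).Nonempty) : IsBlock (B ∩ c.pos) := by
  have : c.pos = {x | inner ℝ (-c.normal) x < -c.2.2} := by
    ext x
    simp [Cut.pos, c.inner_normal]
  rw [this] at hne ⊢
  exact hB.inter_halfSpace hne

lemma IsBlock.nonempty_inter {B : Set (EuclideanSpace ℝ (Fin d))} (hB : IsBlock B) (c : Cut d) :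
    (B ∩ c.neg).Nonempty ∨ (B ∩ c.pos).Nonempty := by
  obtain ⟨x, hx⟩ := hB.nonempty_interior
  rcases lt_trichotomy (c.eval x) 0 with h | h | h
  · exact .inl ⟨x, interior_subset hx, h⟩
  · right
    have hcont : Continuous fun t : ℝ => x + t • c.normal := by fun_prop
    have hev : ∀ᶠ t in nhdsWithin (0 : ℝ) (Ioi 0), x + t • c.normal ∈ interior B :=
      nhdsWithin_le_nhds (hcont.continuousAt.eventually_mem
        (isOpen_interior.mem_nhds (by simpa using hx)))
    obtain ⟨t, h1, h2⟩ := (hev.and self_mem_nhdsWithin).exists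
    refine ⟨_, interior_subset h1, ?_⟩
    rw [Cut.pos, mem_ofPred_eq, c.eval_add_smul_normal, h, zero_add]
    exact h2
  · exact .inr ⟨x, interior_subset hx, h⟩

variable {L : Type} {cut : L → Cut d}

lemma subset_of_mem_leaves {B : Set (EuclideanSpace ℝ (Fin d))} {T : BinaryTree L}
    {b : Set (EuclideanSpace ℝ (Fin d)) × (L → BinaryTree L)} (hb : b ∈ leaves cut B T) :
    b.1 ⊆ B := by
  induction T generalizing B b with
  | nil =>
    simp only [leaves, List.mem_singleton] at hb
    rw [hb]
  | node a l r hl hr =>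
    simp only [leaves, List.mem_append, List.mem_map] at hb
    rcases hb with ⟨b, hb, rfl⟩ | ⟨b, hb, rfl⟩
    · exact (hl hb).trans inter_subset_left
    · exact (hr hb).trans inter_subset_left

lemma eq_empty_or_isBlock_of_mem_leaves {B : Set (EuclideanSpace ℝ (Fin d))}
    (hB : B = ∅ ∨ IsBlock B) {T : BinaryTree L}
    {b : Set (EuclideanSpace ℝ (Fin d)) × (L → BinaryTree L)} (hb : b ∈ leaves cut B T) :
    b.1 = ∅ ∨ IsBlock b.1 := by
  induction T generalizing B b with
  | nil =>
    simp only [leaves, List.mem_singleton] at hb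
    rwa [hb]
  | node a l r hl hr =>
    simp only [leaves, List.mem_append, List.mem_map] at hb
    rcases hb with ⟨b₀, hb₀, rfl⟩ | ⟨b₀, hb₀, rfl⟩
    · have hB' : B ∩ (cut a).neg = ∅ ∨ IsBlock (B ∩ (cut a).neg) := by
        rcases (B ∩ (cut a).neg).eq_empty_or_nonempty with h | h
        · exact .inl h
        · exact .inr ((hB.resolve_left (h.mono inter_subset_left).ne_empty).inter_neg h)
      exact hl (b := b₀) hB' hb₀
    · have hB' : B ∩ (cut a).pos = ∅ ∨ IsBlock (B ∩ (cut a).pos) := by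
        rcases (B ∩ (cut a).pos).eq_empty_or_nonempty with h | h
        · exact .inl h
        · exact .inr ((hB.resolve_left (h.mono inter_subset_left).ne_empty).inter_pos h)
      exact hr (b := b₀) hB' hb₀

lemma exists_isBlock_mem_leaves {B : Set (EuclideanSpace ℝ (Fin d))} (hB : IsBlock B)
    (T : BinaryTree L) : ∃ b ∈ leaves cut B T, IsBlock b.1 := by
  induction T generalizing B with
  | nil => exact ⟨_, List.mem_singleton_self _, hB⟩
  | node a l r hl hr =>
    rcases hB.nonempty_inter (cut a) with h | h
    · obtain ⟨b, hb, hb'⟩ := hl (hB.inter_neg h)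
      exact ⟨_, List.mem_append_left _ (List.mem_map_of_mem hb), hb'⟩
    · obtain ⟨b, hb, hb'⟩ := hr (hB.inter_pos h)
      exact ⟨_, List.mem_append_right _ (List.mem_map_of_mem hb), hb'⟩

/-! ### Perimeters as measures of sets of lines -/

/-- The coordinate projection onto the pair of dimensions `p`, as a continuous linear map. -/
noncomputable def projL (p : DimPair d) : EuclideanSpace ℝ (Fin d) →L[ℝ] EuclideanSpace ℝ (Fin 2) :=
  LinearMap.toContinuousLinearMap
    { toFun := proj p
      map_add' := fun x y => by ext i; fin_cases i <;> simp [proj]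
      map_smul' := fun a x => by ext i; fin_cases i <;> simp [proj] }

lemma proj_surjective (p : DimPair d) : Function.Surjective (proj p) := by
  intro y
  refine ⟨EuclideanSpace.single p.1.1 (y 0) + EuclideanSpace.single p.1.2 (y 1), ?_⟩
  have hne : p.1.1 ≠ p.1.2 := p.2.ne
  ext i
  fin_cases i <;> simp [proj, hne, hne.symm]

lemma IsBlock.nonempty_interior_image {B : Set (EuclideanSpace ℝ (Fin d))} (hB : IsBlock B)
    (p : DimPair d) : (interior (proj p '' B)).Nonempty := by
  have hopen : IsOpen (proj p '' interior B) :=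
    (projL p).isOpenMap (proj_surjective p) _ isOpen_interior
  exact (hB.nonempty_interior.image _).mono (interior_maximal (image_mono interior_subset) hopen)

lemma IsBlock.convex_image {B : Set (EuclideanSpace ℝ (Fin d))} (hB : IsBlock B)
    (p : DimPair d) : Convex ℝ (proj p '' B) := hB.convex.linear_image (projL p).toLinearMap

lemma IsBlock.perimeter_eq {B : Set (EuclideanSpace ℝ (Fin d))} (hB : IsBlock B)
    (p : DimPair d) :
    perimeter (proj p '' B) = ∫⁻ θ in Ioc 0 Real.pi, volume (segment (proj p '' B) θ) := by
  classical
  obtain ⟨H, hH⟩ := hB.exists_closure_eq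
  obtain ⟨F, hF⟩ := exists_eq_convexHull (H := H) (hH ▸ hB.isBounded.closure)
  refine perimeter_eq_lintegral (hB.convex_image p) (hB.nonempty_interior_image p)
    (F := F.image (proj p)) ?_
  have hcomp : IsCompact (closure B) :=
    Metric.isCompact_of_isClosed_isBounded isClosed_closure hB.isBounded.closure
  have h1 : closure (proj p '' B) = proj p '' closure B := by
    refine subset_antisymm (closure_minimal (image_mono subset_closure)
      (hcomp.image (projL p).continuous).isClosed) ?_
    exact image_closure_subset_closure_image (projL p).continuous
  rw [h1, hH, hF, Finset.coe_image]
  exact (projL p).toLinearMap.image_convexHull _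

/-- The invariant measure on the lines of the plane, with directions in `(0, π]`. -/
noncomputable def lineMeasure : Measure (ℝ × ℝ) := (volume.restrict (Ioc 0 Real.pi)).prod volume

instance : SFinite lineMeasure := by unfold lineMeasure; infer_instance

/-- The lines whose inverse image by the projection onto the pair of dimensions `p` meets `B`. -/
def hitLines (B : Set (EuclideanSpace ℝ (Fin d))) (p : DimPair d) : Set (ℝ × ℝ) :=
  Prod.mk p ⁻¹' hit B

lemma segment_image_proj (B : Set (EuclideanSpace ℝ (Fin d))) (p : DimPair d) (θ : ℝ) :
    segment (proj p '' B) θ = Prod.mk θ ⁻¹' hitLines B p := by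
  ext u
  simp only [segment, image_image, hitLines, hit, Cut.eval, mem_preimage, mem_ofPred_eq, mem_image,
    sub_eq_zero]
  rfl

lemma IsBlock.measurableSet_hit {B : Set (EuclideanSpace ℝ (Fin d))} (hB : IsBlock B) :
    MeasurableSet (hit B) := hB.hitMeasurable.measurableSet_hit_const

lemma IsBlock.measurableSet_hitLines {B : Set (EuclideanSpace ℝ (Fin d))} (hB : IsBlock B)
    (p : DimPair d) : MeasurableSet (hitLines B p) := measurable_prodMk_left hB.measurableSet_hit

lemma IsBlock.perimeter_eq_lineMeasure {B : Set (EuclideanSpace ℝ (Fin d))} (hB : IsBlock B)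
    (p : DimPair d) : perimeter (proj p '' B) = lineMeasure (hitLines B p) := by
  rw [hB.perimeter_eq, lineMeasure, Measure.prod_apply (hB.measurableSet_hitLines p)]
  simp only [segment_image_proj]

lemma volume_segment_le {K : Set (EuclideanSpace ℝ (Fin 2))} {R : ℝ}
    (hR : ∀ x ∈ K, ‖x‖ ≤ R) (θ : ℝ) : volume (segment K θ) ≤ ENNReal.ofReal (4 * R) := by
  have : segment K θ ⊆ Icc (-(2 * R)) (2 * R) := by
    rintro _ ⟨x, hx, rfl⟩
    have h0 : |x 0| ≤ R := (by simpa using PiLp.norm_apply_le x 0 : |x 0| ≤ ‖x‖).trans (hR x hx)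
    have h1 : |x 1| ≤ R := (by simpa using PiLp.norm_apply_le x 1 : |x 1| ≤ ‖x‖).trans (hR x hx)
    rw [mem_Icc, ← abs_le]
    calc |x 0 * Real.cos θ + x 1 * Real.sin θ|
        ≤ |x 0 * Real.cos θ| + |x 1 * Real.sin θ| := abs_add_le _ _
      _ = |x 0| * |Real.cos θ| + |x 1| * |Real.sin θ| := by rw [abs_mul, abs_mul]
      _ ≤ R * 1 + R * 1 := by
          gcongr
          · exact (abs_nonneg _).trans h0
          · exact Real.abs_cos_le_one θ
          · exact (abs_nonneg _).trans h1
          · exact Real.abs_sin_le_one θ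
      _ = 2 * R := by ring
  refine (measure_mono this).trans ?_
  rw [Real.volume_Icc]
  exact ENNReal.ofReal_le_ofReal (by linarith)

lemma IsBlock.volume_segment_pos {B : Set (EuclideanSpace ℝ (Fin d))} (hB : IsBlock B)
    (p : DimPair d) (θ : ℝ) : 0 < volume (segment (proj p '' B) θ) := by
  rw [volume_image_eq_volume_image_interior (hB.convex_image p) (hB.nonempty_interior_image p)
    interior_subset subset_closure]
  exact ((normalForm θ).isOpenMap (normalForm_surjective θ) _ isOpen_interior).measure_pos volume
    ((hB.nonempty_interior_image p).image _)

lemma IsBlock.exists_volume_segment_le {B : Set (EuclideanSpace ℝ (Fin d))} (hB : IsBlock B)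
    (p : DimPair d) : ∃ R : ℝ, ∀ θ, volume (segment (proj p '' B) θ) ≤ ENNReal.ofReal R := by
  obtain ⟨R, hR⟩ := ((projL p).lipschitz.isBounded_image hB.isBounded).exists_norm_le
  exact ⟨_, volume_segment_le hR⟩

lemma IsBlock.lineMeasure_hitLines_ne_top {B : Set (EuclideanSpace ℝ (Fin d))} (hB : IsBlock B)
    (p : DimPair d) : lineMeasure (hitLines B p) ≠ ∞ := by
  rw [← hB.perimeter_eq_lineMeasure, hB.perimeter_eq]
  obtain ⟨R, hR⟩ := hB.exists_volume_segment_le p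
  refine ne_top_of_le_ne_top ?_ (lintegral_mono hR)
  rw [setLIntegral_const]
  exact ENNReal.mul_ne_top ENNReal.ofReal_ne_top (by simp)

lemma IsBlock.lineMeasure_hitLines_ne_zero {B : Set (EuclideanSpace ℝ (Fin d))} (hB : IsBlock B)
    (p : DimPair d) : lineMeasure (hitLines B p) ≠ 0 := by
  rw [← hB.perimeter_eq_lineMeasure, hB.perimeter_eq]
  have hmeas : Measurable fun θ => volume (segment (proj p '' B) θ) := by
    simp only [segment_image_proj]
    exact measurable_measure_prodMk_left (hB.measurableSet_hitLines p)
  refine (setLIntegral_pos_iff hmeas).2 ?_ |>.ne'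
  have : Function.support (fun θ => volume (segment (proj p '' B) θ)) = univ :=
    eq_univ_of_forall fun θ => (hB.volume_segment_pos p θ).ne'
  rw [this, univ_inter, Real.volume_Ioc]
  simp [Real.pi_pos]

lemma cutMeasure_eq : cutMeasure d = Measure.count.prod lineMeasure := rfl

lemma lintegral_hit {B : Set (EuclideanSpace ℝ (Fin d))} (hB : MeasurableSet (hit B))
    {f : Cut d → ℝ≥0∞} (hf : Measurable f) :
    ∫⁻ c in hit B, f c ∂cutMeasure d =
      ∑ p : DimPair d, ∫⁻ y in hitLines B p, f (p, y) ∂lineMeasure := by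
  rw [← lintegral_indicator hB, cutMeasure_eq,
    lintegral_prod _ (hf.indicator hB).aemeasurable, lintegral_count, tsum_fintype]
  refine Finset.sum_congr rfl fun p _ => ?_
  have hp : MeasurableSet (hitLines B p) := measurable_prodMk_left hB
  rw [← lintegral_indicator hp]
  rfl

lemma IsBlock.totalPerimeter_eq {B : Set (EuclideanSpace ℝ (Fin d))} (hB : IsBlock B) :
    totalPerimeter B = cutMeasure d (hit B) := by
  have := lintegral_hit hB.measurableSet_hit (f := 1) measurable_one
  simp only [Pi.one_apply, lintegral_one, Measure.restrict_apply_univ] at this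
  rw [this, totalPerimeter]
  exact Finset.sum_congr rfl fun p _ => hB.perimeter_eq_lineMeasure p

lemma totalPerimeter_empty : totalPerimeter (∅ : Set (EuclideanSpace ℝ (Fin d))) = 0 := by
  simp [totalPerimeter, perimeter]

lemma IsBlock.cutMeasure_hit_ne_top {B : Set (EuclideanSpace ℝ (Fin d))} (hB : IsBlock B) :
    cutMeasure d (hit B) ≠ ∞ := by
  rw [← hB.totalPerimeter_eq, totalPerimeter]
  refine (ENNReal.sum_lt_top.2 fun p _ => ?_).ne
  rw [hB.perimeter_eq_lineMeasure]
  exact (hB.lineMeasure_hitLines_ne_top p).lt_top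

lemma IsBlock.cutMeasure_hit_ne_zero (hd : 2 ≤ d) {B : Set (EuclideanSpace ℝ (Fin d))}
    (hB : IsBlock B) : cutMeasure d (hit B) ≠ 0 := by
  rw [← hB.totalPerimeter_eq, totalPerimeter]
  intro h
  rw [Finset.sum_eq_zero_iff] at h
  have := h ⟨(⟨0, by omega⟩, ⟨1, by omega⟩), by simp [Fin.lt_def]⟩ (Finset.mem_univ _)
  rw [hB.perimeter_eq_lineMeasure] at this
  exact hB.lineMeasure_hitLines_ne_zero _ this

/-- The law of the cutting line is the normalised restriction of the invariant measure to the
lines that meet the region. -/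
lemma IsBlock.lineLaw_eq {B : Set (EuclideanSpace ℝ (Fin d))} (hB : IsBlock B) (p : DimPair d) :
    lineLaw (proj p '' B) =
      (lineMeasure (hitLines B p))⁻¹ • lineMeasure.restrict (hitLines B p) := by
  have hm := hB.measurableSet_hitLines p
  have hsegm : ∀ θ, MeasurableSet (segment (proj p '' B) θ) := fun θ => by
    rw [segment_image_proj]
    exact measurable_prodMk_left hm
  have hker : ∀ {A : Set (ℝ × ℝ)}, MeasurableSet A → ∀ θ,
      (cond volume (segment (proj p '' B) θ)).map (fun u => (θ, u)) A =
        (volume (segment (proj p '' B) θ))⁻¹ * volume (Prod.mk θ ⁻¹' (hitLines B p ∩ A)) := by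
    intro A hA θ
    rw [Measure.map_apply measurable_prodMk_left hA, cond_apply (hsegm θ), segment_image_proj]
    rfl
  have hvolm : Measurable fun θ => volume (segment (proj p '' B) θ) := by
    simp only [segment_image_proj]
    exact measurable_measure_prodMk_left hm
  have hkerm : Measurable fun θ =>
      (cond volume (segment (proj p '' B) θ)).map (fun u => (θ, u)) := by
    refine Measure.measurable_of_measurable_coe _ fun A hA => ?_
    simp only [hker hA]
    exact hvolm.inv.mul (measurable_measure_prodMk_left (hm.inter hA))
  ext A hA
  rw [lineLaw, Measure.bind_apply hA hkerm.aemeasurable]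
  simp only [hker hA]
  have hfm : Measurable fun θ => (volume (segment (proj p '' B) θ))⁻¹ *
      volume (Prod.mk θ ⁻¹' (hitLines B p ∩ A)) :=
    hvolm.inv.mul (measurable_measure_prodMk_left (hm.inter hA))
  rw [directionLaw, lintegral_smul_measure, ← hB.perimeter_eq, hB.perimeter_eq_lineMeasure,
    lintegral_withDensity_eq_lintegral_mul _ hvolm hfm]
  rw [Measure.smul_apply, Measure.restrict_apply hA, inter_comm A, lineMeasure,
    Measure.prod_apply (hm.inter hA)]
  congr 1
  refine lintegral_congr fun θ => ?_
  obtain ⟨R, hR⟩ := hB.exists_volume_segment_le p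
  rw [Pi.mul_apply, ← mul_assoc, ENNReal.mul_inv_cancel (hB.volume_segment_pos p θ).ne'
    (ne_top_of_le_ne_top ENNReal.ofReal_ne_top (hR θ)), one_mul]

end Block

/-! ### Integrals of exponential densities -/

section Exponential

lemma lintegral_expMeasure {r : ℝ} {f : ℝ → ℝ≥0∞} (hf : Measurable f) :
    ∫⁻ x, f x ∂expMeasure r =
      ∫⁻ x in Ioi 0, ENNReal.ofReal (r * Real.exp (-(r * x))) * f x := by
  have hm : Measurable (exponentialPDF r) :=
    (measurable_exponentialPDFReal r).ennreal_ofReal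
  have hdef : expMeasure r = volume.withDensity (exponentialPDF r) := rfl
  rw [hdef, lintegral_withDensity_eq_lintegral_mul _ hm hf, setLIntegral_congr Ioi_ae_eq_Ici,
    ← lintegral_indicator measurableSet_Ici]
  refine lintegral_congr fun x => ?_
  by_cases hx : 0 ≤ x
  · rw [indicator_of_mem (mem_Ici.2 hx), Pi.mul_apply, exponentialPDF_of_nonneg hx]
  · rw [indicator_of_notMem (by simpa using hx), Pi.mul_apply,
      exponentialPDF_of_neg (not_le.1 hx), zero_mul]

lemma lintegral_exp_Ioi {v : ℝ} (hv : 0 < v) (a : ℝ) :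
    ∫⁻ x in Ioi a, ENNReal.ofReal (v * Real.exp (-(v * x))) =
      ENNReal.ofReal (Real.exp (-(v * a))) := by
  have hform : ∀ x, v * Real.exp (-(v * x)) = v * Real.exp (-v * x) := fun x => by ring_nf
  simp only [hform]
  rw [← ofReal_integral_eq_lintegral_ofReal
    ((integrableOn_exp_mul_Ioi (neg_lt_zero.2 hv) a).const_mul v)
    (.of_forall fun x => by positivity), integral_const_mul,
    integral_exp_mul_Ioi (neg_lt_zero.2 hv)]
  congr 1
  field_simp

lemma lintegral_exp_Ioc {v s r : ℝ} (hv : 0 ≤ v) (hsr : s ≤ r) :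
    ∫⁻ t in Ioc s r, ENNReal.ofReal (v * Real.exp (-(v * (t - s)))) =
      ENNReal.ofReal (1 - Real.exp (-(v * (r - s)))) := by
  have hcont : Continuous fun t => v * Real.exp (-(v * (t - s))) := by fun_prop
  rw [← ofReal_integral_eq_lintegral_ofReal
    (hcont.integrableOn_Icc.mono_set Ioc_subset_Icc_self) (.of_forall fun x => by positivity),
    ← intervalIntegral.integral_of_le hsr,
    intervalIntegral.integral_eq_sub_of_hasDerivAt (f := fun t => -Real.exp (-(v * (t - s))))]
  · simp
    ring_nf
  · intro t _
    have h1 : HasDerivAt (fun t => -(v * (t - s))) (-(v * 1)) t :=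
      (((hasDerivAt_id t).sub_const s).const_mul v).neg
    have h2 := h1.exp.neg
    have hval : v * Real.exp (-(v * (t - s))) = -(Real.exp (-(v * (t - s))) * -(v * 1)) := by ring
    rw [hval]
    exact h2
  · exact hcont.intervalIntegrable _ _

end Exponential

/-! ### One step of the process -/

section Step

variable {d : ℕ}

lemma lintegral_list_sum {α β : Type*} [MeasurableSpace α] (μ : Measure α) (l : List β)
    {f : β → α → ℝ≥0∞} (hf : ∀ b ∈ l, Measurable (f b)) :
    ∫⁻ a, (l.map fun b => f b a).sum ∂μ = (l.map fun b => ∫⁻ a, f b a ∂μ).sum := by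
  induction l with
  | nil => simp
  | cons b l ih =>
    simp only [List.map_cons, List.sum_cons]
    rw [lintegral_add_left (hf b (by simp)), ih fun b hb => hf b (by simp [hb])]

lemma lintegral_list_sum_measure {α β : Type*} [MeasurableSpace α] (l : List β)
    (μ : β → Measure α) (f : α → ℝ≥0∞) :
    ∫⁻ a, f a ∂(l.map μ).sum = (l.map fun b => ∫⁻ a, f a ∂μ b).sum := by
  induction l with
  | nil => simp
  | cons b l ih =>
    simp only [List.map_cons, List.sum_cons]
    rw [lintegral_add_measure, ih]

/-- The sum of the measures of the sets of cuts that hit the terminal nodes, which is the rate of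
the next cut. -/
noncomputable def rate (P : Set (EuclideanSpace ℝ (Fin d))) (T : TimedTree d) : ℝ≥0∞ :=
  leafInt P 0 (fun _ => 1) T

variable {P : Set (EuclideanSpace ℝ (Fin d))}

lemma leafInt_const (t : ℝ) (a : ℝ≥0∞) (T : TimedTree d) :
    leafInt P t (fun _ => a) T = rate P T * a := by
  simp only [rate, leafInt, lintegral_const, one_mul, Measure.restrict_apply_univ]
  rw [← List.sum_map_mul_right]
  simp only [mul_comm]

lemma IsBlock.leaf_cases (hP : IsBlock P) {T : TimedTree d}
    {b : Set (EuclideanSpace ℝ (Fin d)) × (ℝ × Cut d → TimedTree d)}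
    (hb : b ∈ leaves Prod.snd P T) : b.1 = ∅ ∨ IsBlock b.1 :=
  eq_empty_or_isBlock_of_mem_leaves (.inr hP) hb

lemma IsBlock.totalPerimeter_leaf (hP : IsBlock P) {T : TimedTree d}
    {b : Set (EuclideanSpace ℝ (Fin d)) × (ℝ × Cut d → TimedTree d)}
    (hb : b ∈ leaves Prod.snd P T) : totalPerimeter b.1 = cutMeasure d (hit b.1) := by
  rcases hP.leaf_cases hb with h | h
  · rw [h, totalPerimeter_empty, hit_empty, measure_empty]
  · exact h.totalPerimeter_eq

lemma IsBlock.sum_totalPerimeter (hP : IsBlock P) (T : TimedTree d) :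
    ((leaves Prod.snd P T).map fun b => totalPerimeter b.1).sum = rate P T := by
  rw [rate, leafInt]
  simp only [lintegral_one, Measure.restrict_apply_univ]
  exact congrArg List.sum (List.map_congr_left fun b hb => hP.totalPerimeter_leaf hb)

/-- A hierarchical partition with `m` terminal nodes is cut at a rate at most `m` times that of
the undivided block. -/
lemma rate_le (T : TimedTree d) :
    rate P T ≤ (leaves Prod.snd P T).length * cutMeasure d (hit P) := by
  rw [rate, leafInt]
  simp only [lintegral_one, Measure.restrict_apply_univ]
  refine (List.sum_le_card_nsmul _ (cutMeasure d (hit P)) ?_).trans_eq ?_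
  · intro x hx
    obtain ⟨b, hb, rfl⟩ := List.mem_map.1 hx
    exact measure_mono (hit_mono (subset_of_mem_leaves hb))
  · simp

lemma IsBlock.rate_ne_top (hP : IsBlock P) (T : TimedTree d) : rate P T ≠ ∞ :=
  ne_top_of_le_ne_top (ENNReal.mul_ne_top (by simp) hP.cutMeasure_hit_ne_top)
    (rate_le T)

lemma IsBlock.rate_ne_zero (hd : 2 ≤ d) (hP : IsBlock P) (T : TimedTree d) : rate P T ≠ 0 := by
  obtain ⟨b, hb, hb'⟩ := exists_isBlock_mem_leaves (cut := Prod.snd) hP T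
  rw [rate, leafInt]
  simp only [lintegral_one, Measure.restrict_apply_univ]
  intro h
  rw [List.sum_eq_zero_iff] at h
  exact hb'.cutMeasure_hit_ne_zero hd (h _ (List.mem_map_of_mem hb))

lemma IsBlock.toReal_rate_pos (hd : 2 ≤ d) (hP : IsBlock P) (T : TimedTree d) :
    0 < (rate P T).toReal :=
  ENNReal.toReal_pos (hP.rate_ne_zero hd T) (hP.rate_ne_top T)

/-- Contribution of one terminal node to one step of the process. -/
lemma IsBlock.lintegral_step_leaf {B : Set (EuclideanSpace ℝ (Fin d))} (hB : IsBlock B) {w : ℝ≥0∞}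
    (hw0 : w ≠ 0) (hw : w ≠ ∞) {f : ℝ × Cut d → ℝ≥0∞} (hf : Measurable f) :
    totalPerimeter B / w * ∑ p : DimPair d, perimeter (proj p '' B) / totalPerimeter B *
        ∫⁻ y, f (y.1, (p, y.2)) ∂(expMeasure w.toReal).prod (lineLaw (proj p '' B)) =
      ∫⁻ e in Ioi 0, ENNReal.ofReal (Real.exp (-(w.toReal * e))) *
        ∫⁻ c in hit B, f (e, c) ∂cutMeasure d := by
  have hwr : 0 < w.toReal := ENNReal.toReal_pos hw0 hw
  have hprod : ∀ p : DimPair d, perimeter (proj p '' B) *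
      ∫⁻ y, f (y.1, (p, y.2)) ∂(expMeasure w.toReal).prod (lineLaw (proj p '' B)) =
      ∫⁻ e, ∫⁻ y in hitLines B p, f (e, (p, y)) ∂lineMeasure ∂expMeasure w.toReal := by
    intro p
    have h0 := hB.lineMeasure_hitLines_ne_zero p
    have hfp : Measurable fun y : ℝ × ℝ × ℝ => f (y.1, (p, y.2)) := by fun_prop
    have hsf : SFinite (lineLaw (proj p '' B)) := by
      rw [hB.lineLaw_eq]
      infer_instance
    rw [lintegral_prod _ hfp.aemeasurable, hB.lineLaw_eq]
    simp only [lintegral_smul_measure, smul_eq_mul]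
    rw [lintegral_const_mul' _ _ (ENNReal.inv_ne_top.2 h0), hB.perimeter_eq_lineMeasure,
      ← mul_assoc,   ENNReal.mul_inv_cancel h0 (hB.lineMeasure_hitLines_ne_top p), one_mul]
  have htp0 : totalPerimeter B ≠ 0 ∨ ∀ p : DimPair d, False := by
    by_cases h : totalPerimeter B = 0
    · right
      intro p
      rw [totalPerimeter, Finset.sum_eq_zero_iff] at h
      exact hB.lineMeasure_hitLines_ne_zero p
        (hB.perimeter_eq_lineMeasure p ▸ h p (Finset.mem_univ p))
    · exact .inl h
  have htp : totalPerimeter B ≠ ∞ := hB.totalPerimeter_eq ▸ hB.cutMeasure_hit_ne_top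
  have hweight : ∀ p : DimPair d, ∀ x : ℝ≥0∞,
      totalPerimeter B / w * (perimeter (proj p '' B) / totalPerimeter B * x) =
        w⁻¹ * (perimeter (proj p '' B) * x) := by
    intro p x
    have h0 := htp0.resolve_right fun h => h p
    calc totalPerimeter B / w * (perimeter (proj p '' B) / totalPerimeter B * x)
        = (totalPerimeter B * (totalPerimeter B)⁻¹) * (w⁻¹ * (perimeter (proj p '' B) * x)) := by
          simp only [div_eq_mul_inv]
          ring
      _ = _ := by rw [ENNReal.mul_inv_cancel h0 htp, one_mul]
  have hmeas : ∀ p : DimPair d,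
      Measurable fun e => ∫⁻ y in hitLines B p, f (e, (p, y)) ∂lineMeasure := by
    intro p
    exact Measurable.lintegral_prod_right' (f := fun z : ℝ × ℝ × ℝ => f (z.1, (p, z.2)))
      (by fun_prop)
  have hhit : ∀ e, ∫⁻ c in hit B, f (e, c) ∂cutMeasure d =
      ∑ p, ∫⁻ y in hitLines B p, f (e, (p, y)) ∂lineMeasure := fun e =>
    lintegral_hit hB.measurableSet_hit (f := fun c => f (e, c)) (by fun_prop)
  rw [Finset.mul_sum]
  simp only [hweight, hprod, hhit]
  rw [← Finset.mul_sum, ← lintegral_finsetSum _ fun p _ => hmeas p,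
    lintegral_expMeasure (Finset.measurable_fun_sum _ fun p _ => hmeas p),
    ← lintegral_const_mul' _ _ (ENNReal.inv_ne_top.2 hw0)]
  refine lintegral_congr fun e => ?_
  rw [← mul_assoc, ENNReal.ofReal_mul hwr.le, ENNReal.ofReal_toReal hw, ← mul_assoc,
    ENNReal.inv_mul_cancel hw0 hw, one_mul]

lemma IsBlock.lintegral_step (hd : 2 ≤ d) (hP : IsBlock P) (s : ℝ × TimedTree d)
    {f : ℝ × TimedTree d → ℝ≥0∞} (hf : Measurable f) :
    ∫⁻ y, f y ∂step P s = ∫⁻ e in Ioi 0, ENNReal.ofReal (Real.exp (-((rate P s.2).toReal * e))) *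
      leafInt P (s.1 + e) (fun T => f (s.1 + e, T)) s.2 := by
  unfold step
  dsimp only
  rw [lintegral_list_sum_measure, hP.sum_totalPerimeter]
  have hleaf : ∀ b ∈ leaves Prod.snd P s.2,
      ∫⁻ y, f y ∂((totalPerimeter b.1 / rate P s.2) •
        ∑ p : DimPair d, (perimeter (proj p '' b.1) / totalPerimeter b.1) •
          ((expMeasure (rate P s.2).toReal).prod (lineLaw (proj p '' b.1))).map
            fun y => (s.1 + y.1, b.2 (s.1 + y.1, (p, y.2)))) =
      ∫⁻ e in Ioi 0, ENNReal.ofReal (Real.exp (-((rate P s.2).toReal * e))) *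
        ∫⁻ c in hit b.1, f (s.1 + e, b.2 (s.1 + e, c)) ∂cutMeasure d := by
    intro b hb
    have hb2 := measurable_of_mem_leaves hb
    rcases hP.leaf_cases hb with h | h
    · rw [h, totalPerimeter_empty]
      simp
    · rw [← h.lintegral_step_leaf (hP.rate_ne_zero hd _) (hP.rate_ne_top _)
        (f := fun y => f (s.1 + y.1, b.2 (s.1 + y.1, y.2))) (by fun_prop)]
      rw [lintegral_smul_measure, lintegral_finsetSum_measure, smul_eq_mul]
      congr 1
      refine Finset.sum_congr rfl fun p _ => ?_
      rw [lintegral_smul_measure, smul_eq_mul, lintegral_map hf (by fun_prop)]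
  rw [List.map_congr_left hleaf, ← lintegral_list_sum]
  · refine lintegral_congr fun e => ?_
    rw [leafInt, List.sum_map_mul_left]
  · intro b hb
    have hb2 := measurable_of_mem_leaves hb
    refine Measurable.mul (by fun_prop) ?_
    exact Measurable.lintegral_prod_right'
      (f := fun z : ℝ × Cut d => f (s.1 + z.1, b.2 (s.1 + z.1, z.2))) (by fun_prop)

lemma measurable_rate (hP : HitMeasurable fun _ : Unit => P) : Measurable (rate P) := by
  have := measurable_leafInt hP (t := fun _ => 0) measurable_const (φ := fun _ _ => 1)
    measurable_const
  exact this.comp (measurable_prodMk_left (x := ()))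

lemma measurable_leafInt_section (hP : HitMeasurable fun _ : Unit => P)
    {f : ℝ × TimedTree d → ℝ≥0∞} (hf : Measurable f) :
    Measurable fun w : ℝ × TimedTree d => leafInt P w.1 (fun T => f (w.1, T)) w.2 :=
  measurable_leafInt (Z := ℝ) (B := fun _ => P)
    (hP.comp (f := fun _ => ()) measurable_const) measurable_id
    (φ := fun t T => f (t, T)) hf

lemma IsBlock.measurable_step (hd : 2 ≤ d) (hP : IsBlock P) : Measurable (step P) := by
  refine Measure.measurable_of_measurable_coe _ fun A hA => ?_
  have hind : Measurable (A.indicator (1 : ℝ × TimedTree d → ℝ≥0∞)) := measurable_one.indicator hA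
  simp only [← lintegral_indicator_one hA, hP.lintegral_step hd _ hind]
  refine Measurable.lintegral_prod_right' (f := fun w : (ℝ × TimedTree d) × ℝ =>
    ENNReal.ofReal (Real.exp (-((rate P w.1.2).toReal * w.2))) *
      leafInt P (w.1.1 + w.2) (fun T => A.indicator 1 (w.1.1 + w.2, T)) w.1.2) ?_
  have hr := measurable_rate hP.hitMeasurable
  refine Measurable.mul (by fun_prop) ?_
  exact (measurable_leafInt_section hP.hitMeasurable hind).comp
    (f := fun w : (ℝ × TimedTree d) × ℝ => (w.1.1 + w.2, w.1.2)) (by fun_prop)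

/-- The integral of a function of the state after one more cut, on the event that this cut is made
within the budget. -/
noncomputable def nextInt (P : Set (EuclideanSpace ℝ (Fin d))) (τ : ℝ)
    (f : ℝ × TimedTree d → ℝ≥0∞) (s : ℝ × TimedTree d) : ℝ≥0∞ :=
  ∫⁻ t in Ioc s.1 τ, ENNReal.ofReal (Real.exp (-((rate P s.2).toReal * (t - s.1)))) *
    leafInt P t (fun T => f (t, T)) s.2

lemma measurable_nextInt (hP : HitMeasurable fun _ : Unit => P) {τ : ℝ}
    {f : ℝ × TimedTree d → ℝ≥0∞} (hf : Measurable f) : Measurable (nextInt P τ f) := by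
  have hr := measurable_rate hP
  have hset : MeasurableSet {w : (ℝ × TimedTree d) × ℝ | w.2 ∈ Ioc w.1.1 τ} := by
    simp only [mem_Ioc, ofPred_and]
    exact (measurableSet_lt (by fun_prop) (by fun_prop)).inter
      (measurableSet_le (by fun_prop) (by fun_prop))
  have : ∀ s, nextInt P τ f s = ∫⁻ t, {w : (ℝ × TimedTree d) × ℝ | w.2 ∈ Ioc w.1.1 τ}.indicator
      (fun w => ENNReal.ofReal (Real.exp (-((rate P w.1.2).toReal * (w.2 - w.1.1)))) *
        leafInt P w.2 (fun T => f (w.2, T)) w.1.2) (s, t) := by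
    intro s
    rw [nextInt, ← lintegral_indicator measurableSet_Ioc]
    rfl
  rw [funext this]
  refine Measurable.lintegral_prod_right'
    (Measurable.indicator (Measurable.mul (by fun_prop) ?_) hset)
  exact (measurable_leafInt_section hP hf).comp
    (f := fun w : (ℝ × TimedTree d) × ℝ => (w.2, w.1.2)) (by fun_prop)

lemma IsBlock.setLIntegral_step (hd : 2 ≤ d) (hP : IsBlock P) (τ : ℝ) (s : ℝ × TimedTree d)
    {f : ℝ × TimedTree d → ℝ≥0∞} (hf : Measurable f) :
    ∫⁻ y in {y | y.1 ≤ τ}, f y ∂step P s = nextInt P τ f s := by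
  have hset : MeasurableSet {y : ℝ × TimedTree d | y.1 ≤ τ} :=
    measurableSet_le measurable_fst measurable_const
  rw [← lintegral_indicator hset, hP.lintegral_step hd s (hf.indicator hset), nextInt,
    ← lintegral_indicator measurableSet_Ioi, ← lintegral_indicator measurableSet_Ioc]
  conv_rhs => rw [← lintegral_add_left_eq_self _ s.1]
  refine lintegral_congr fun e => ?_
  by_cases he : 0 < e
  · by_cases hτ : s.1 + e ≤ τ
    · rw [indicator_of_mem (mem_Ioi.2 he),
        indicator_of_mem (s := Ioc s.1 τ) ⟨by linarith, hτ⟩, add_sub_cancel_left]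
      congr 2
      funext T
      exact indicator_of_mem (show (s.1 + e, T) ∈ {y : ℝ × TimedTree d | y.1 ≤ τ} from hτ) f
    · rw [indicator_of_mem (mem_Ioi.2 he), indicator_of_notMem fun h => hτ h.2]
      have : ∀ T, {y : ℝ × TimedTree d | y.1 ≤ τ}.indicator f (s.1 + e, T) = 0 :=
        fun T => indicator_of_notMem (by simpa using hτ) f
      simp only [this, leafInt_const, mul_zero]
  · rw [indicator_of_notMem (s := Ioi 0) (by simpa using he), indicator_of_notMem]
    rintro ⟨h, -⟩
    exact he (by linarith)

lemma IsBlock.step_Ioi (hd : 2 ≤ d) (hP : IsBlock P) {τ : ℝ} {s : ℝ × TimedTree d}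
    (hs : s.1 ≤ τ) : step P s {y | τ < y.1} =
      ENNReal.ofReal (Real.exp (-((rate P s.2).toReal * (τ - s.1)))) := by
  have hset : MeasurableSet {y : ℝ × TimedTree d | τ < y.1} :=
    measurableSet_lt measurable_const measurable_fst
  rw [← lintegral_indicator_one hset, hP.lintegral_step hd s (measurable_one.indicator hset),
    ← lintegral_exp_Ioi (hP.toReal_rate_pos hd _), ← lintegral_indicator measurableSet_Ioi,
    ← lintegral_indicator measurableSet_Ioi]
  refine lintegral_congr fun e => ?_
  by_cases hτ : τ - s.1 < e
  · have : ∀ T, {y : ℝ × TimedTree d | τ < y.1}.indicator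
        (1 : ℝ × TimedTree d → ℝ≥0∞) (s.1 + e, T) = 1 :=
      fun T => indicator_of_mem (mem_ofPred.2 (by simpa using sub_lt_iff_lt_add'.1 hτ)) _
    rw [indicator_of_mem (mem_Ioi.2 hτ), indicator_of_mem (mem_Ioi.2 (by linarith))]
    simp only [this, leafInt_const, mul_one]
    rw [ENNReal.ofReal_mul ENNReal.toReal_nonneg, ENNReal.ofReal_toReal (hP.rate_ne_top _),
      mul_comm]
  · have : ∀ T, {y : ℝ × TimedTree d | τ < y.1}.indicator
        (1 : ℝ × TimedTree d → ℝ≥0∞) (s.1 + e, T) = 0 :=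
      fun T => indicator_of_notMem
        (fun h : (s.1 + e, T) ∈ {y : ℝ × TimedTree d | τ < y.1} => hτ (sub_lt_iff_lt_add'.2 h)) _
    rw [indicator_of_notMem (s := Ioi (τ - s.1)) (by simpa using hτ)]
    refine indicator_apply_eq_zero.2 fun _ => ?_
    simp only [this, leafInt_const, mul_zero]

end Step

/-! ### The law of the process as a sum of iterated integrals -/

section Law

variable {d : ℕ} {P : Set (EuclideanSpace ℝ (Fin d))} {τ : ℝ}

/-- The integral of a function of the current partition, on the event that no further cut is made
within the budget. -/
noncomputable def stayInt (P : Set (EuclideanSpace ℝ (Fin d))) (τ : ℝ) (f : TimedTree d → ℝ≥0∞)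
    (s : ℝ × TimedTree d) : ℝ≥0∞ :=
  ENNReal.ofReal (Real.exp (-((rate P s.2).toReal * (τ - s.1)))) * f s.2

lemma measurable_stayInt (hP : HitMeasurable fun _ : Unit => P) {f : TimedTree d → ℝ≥0∞}
    (hf : Measurable f) : Measurable (stayInt P τ f) := by
  have hr := measurable_rate hP
  unfold stayInt
  fun_prop

lemma measurable_iterate_nextInt (hP : HitMeasurable fun _ : Unit => P)
    {f : ℝ × TimedTree d → ℝ≥0∞} (hf : Measurable f) (n : ℕ) :
    Measurable ((nextInt P τ)^[n] f) := by
  induction n with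
  | zero => exact hf
  | succ n ih =>
    rw [Function.iterate_succ']
    exact measurable_nextInt hP ih

lemma leafInt_mono {B : Set (EuclideanSpace ℝ (Fin d))} {t : ℝ} {φ ψ : TimedTree d → ℝ≥0∞}
    {T : TimedTree d} (h : ∀ b ∈ leaves Prod.snd B T, ∀ c, φ (b.2 (t, c)) ≤ ψ (b.2 (t, c))) :
    leafInt B t φ T ≤ leafInt B t ψ T :=
  List.sum_le_sum fun b hb => lintegral_mono fun c => h b hb c

lemma nextInt_mono {f g : ℝ × TimedTree d → ℝ≥0∞} {s : ℝ × TimedTree d}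
    (h : ∀ t ∈ Ioc s.1 τ, ∀ b ∈ leaves Prod.snd P s.2, ∀ c,
      f (t, b.2 (t, c)) ≤ g (t, b.2 (t, c))) : nextInt P τ f s ≤ nextInt P τ g s := by
  refine setLIntegral_mono' measurableSet_Ioc fun t ht => ?_
  gcongr
  exact leafInt_mono (h t ht)

lemma iterate_nextInt_congr {f g : ℝ × TimedTree d → ℝ≥0∞} (h : ∀ s, s.1 ≤ τ → f s = g s) (n : ℕ) :
    ∀ s, s.1 ≤ τ → (nextInt P τ)^[n] f s = (nextInt P τ)^[n] g s := by
  induction n with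
  | zero => exact h
  | succ n ih =>
    intro s _
    rw [Function.iterate_succ_apply', Function.iterate_succ_apply']
    exact le_antisymm (nextInt_mono fun t ht b _ c => (ih _ ht.2).le)
      (nextInt_mono fun t ht b _ c => (ih _ ht.2).ge)

lemma IsBlock.lintegral_accepted (hd : 2 ≤ d) (hP : IsBlock P) (n : ℕ)
    {f : ℝ × TimedTree d → ℝ≥0∞} (hf : Measurable f) :
    ∫⁻ s, f s ∂accepted P τ n = (nextInt P τ)^[n] f (0, .nil) := by
  induction n generalizing f with
  | zero =>
    rw [accepted, lintegral_dirac' _ hf]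
    rfl
  | succ n ih =>
    have hset : MeasurableSet {s : ℝ × TimedTree d | s.1 ≤ τ} :=
      measurableSet_le measurable_fst measurable_const
    rw [accepted, ← lintegral_indicator hset, Measure.lintegral_bind
      (hP.measurable_step hd).aemeasurable (hf.indicator hset).aemeasurable]
    simp only [lintegral_indicator hset, hP.setLIntegral_step hd τ _ hf]
    rw [ih (measurable_nextInt hP.hitMeasurable hf), Function.iterate_succ_apply]

lemma IsBlock.lintegral_law (hd : 2 ≤ d) (hP : IsBlock P) (hτ : 0 ≤ τ) {f : TimedTree d → ℝ≥0∞}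
    (hf : Measurable f) :
    ∫⁻ T, f T ∂law P τ = ∑' n, (nextInt P τ)^[n] (stayInt P τ f) (0, .nil) := by
  have hset : MeasurableSet {s : ℝ × TimedTree d | τ < s.1} :=
    measurableSet_lt measurable_const measurable_fst
  have hm : Measurable fun s => step P s {s' | τ < s'.1} :=
    (Measure.measurable_coe hset).comp (hP.measurable_step hd)
  rw [law, lintegral_sum_measure]
  refine tsum_congr fun n => ?_
  have hf' : Measurable fun s : ℝ × TimedTree d => f s.2 := hf.comp measurable_snd
  rw [lintegral_map hf measurable_snd, lintegral_withDensity_eq_lintegral_mul _ hm hf',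
    hP.lintegral_accepted hd n (hm.mul hf')]
  refine iterate_nextInt_congr (fun s hs => ?_) n _ hτ
  rw [Pi.mul_apply, hP.step_Ioi hd hs]
  rfl

lemma leafInt_add {B : Set (EuclideanSpace ℝ (Fin d))} (t : ℝ) {φ : TimedTree d → ℝ≥0∞}
    (hφ : Measurable φ) (ψ : TimedTree d → ℝ≥0∞) (T : TimedTree d) :
    leafInt B t (fun T => φ T + ψ T) T = leafInt B t φ T + leafInt B t ψ T := by
  simp only [leafInt]
  rw [← List.sum_map_add]
  refine congrArg List.sum (List.map_congr_left fun b hb => ?_)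
  have hb2 := measurable_of_mem_leaves hb
  exact lintegral_add_left (by fun_prop) _

lemma leafInt_tsum {B : Set (EuclideanSpace ℝ (Fin d))} (t : ℝ) {φ : ℕ → TimedTree d → ℝ≥0∞}
    (hφ : ∀ n, Measurable (φ n)) (T : TimedTree d) :
    leafInt B t (fun T => ∑' n, φ n T) T = ∑' n, leafInt B t (φ n) T := by
  have key : ∀ l : List (Set (EuclideanSpace ℝ (Fin d)) × (ℝ × Cut d → TimedTree d)),
      (∀ b ∈ l, Measurable b.2) →
      (l.map fun b => ∫⁻ c in hit b.1, ∑' n, φ n (b.2 (t, c)) ∂cutMeasure d).sum =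
        ∑' n, (l.map fun b => ∫⁻ c in hit b.1, φ n (b.2 (t, c)) ∂cutMeasure d).sum := by
    intro l hl
    induction l with
    | nil => simp
    | cons b l ih =>
      have hb2 : Measurable b.2 := hl b (by simp)
      simp only [List.map_cons, List.sum_cons]
      rw [ENNReal.tsum_add, ih fun b hb => hl b (by simp [hb]),
        lintegral_tsum fun n => (by fun_prop : Measurable fun c => φ n (b.2 (t, c))).aemeasurable]
  exact key _ fun b hb => measurable_of_mem_leaves hb

lemma measurable_nextInt_integrand (hP : HitMeasurable fun _ : Unit => P)
    {f : ℝ × TimedTree d → ℝ≥0∞} (hf : Measurable f) (s : ℝ × TimedTree d) :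
    Measurable fun t => ENNReal.ofReal (Real.exp (-((rate P s.2).toReal * (t - s.1)))) *
      leafInt P t (fun T => f (t, T)) s.2 :=
  Measurable.mul (by fun_prop) ((measurable_leafInt_section hP hf).comp
    (f := fun t : ℝ => (t, s.2)) (by fun_prop))

lemma nextInt_add (hP : HitMeasurable fun _ : Unit => P) {f g : ℝ × TimedTree d → ℝ≥0∞}
    (hf : Measurable f) : nextInt P τ (f + g) = nextInt P τ f + nextInt P τ g := by
  ext s
  have : ∀ t, leafInt P t (fun T => (f + g) (t, T)) s.2 =
      leafInt P t (fun T => f (t, T)) s.2 + leafInt P t (fun T => g (t, T)) s.2 :=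
    fun t => leafInt_add t (φ := fun T => f (t, T)) (by fun_prop) _ _
  rw [Pi.add_apply, nextInt, nextInt, nextInt]
  simp only [this, mul_add]
  exact lintegral_add_left (measurable_nextInt_integrand hP hf s) _

lemma nextInt_tsum (hP : HitMeasurable fun _ : Unit => P) {f : ℕ → ℝ × TimedTree d → ℝ≥0∞}
    (hf : ∀ n, Measurable (f n)) (s : ℝ × TimedTree d) :
    nextInt P τ (fun s => ∑' n, f n s) s = ∑' n, nextInt P τ (f n) s := by
  have : ∀ t, leafInt P t (fun T => ∑' n, f n (t, T)) s.2 =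
      ∑' n, leafInt P t (fun T => f n (t, T)) s.2 :=
    fun t => leafInt_tsum t (φ := fun n T => f n (t, T)) (fun n => by fun_prop) _
  simp only [nextInt, this, ← ENNReal.tsum_mul_left]
  exact lintegral_tsum fun n => (measurable_nextInt_integrand hP (hf n) s).aemeasurable

lemma iterate_nextInt_add (hP : HitMeasurable fun _ : Unit => P) {f g : ℝ × TimedTree d → ℝ≥0∞}
    (hf : Measurable f) (n : ℕ) :
    (nextInt P τ)^[n] (f + g) = (nextInt P τ)^[n] f + (nextInt P τ)^[n] g := by
  induction n with
  | zero => rfl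
  | succ n ih =>
    rw [Function.iterate_succ_apply', ih, nextInt_add hP (measurable_iterate_nextInt hP hf n)]
    simp only [Function.iterate_succ_apply']

lemma nextInt_sum_range (hP : HitMeasurable fun _ : Unit => P) {f : ℕ → ℝ × TimedTree d → ℝ≥0∞}
    (hf : ∀ n, Measurable (f n)) (N : ℕ) :
    nextInt P τ (∑ n ∈ Finset.range N, f n) = ∑ n ∈ Finset.range N, nextInt P τ (f n) := by
  induction N with
  | zero =>
    ext s
    have := fun t => leafInt_const (P := P) t 0 s.2
    simp only [mul_zero] at this
    simp [nextInt, this]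
  | succ N ih =>
    have hm : Measurable (∑ n ∈ Finset.range N, f n) := by
      simpa only [Finset.sum_fn] using Finset.measurable_sum (Finset.range N) fun n _ => hf n
    rw [Finset.sum_range_succ, Finset.sum_range_succ, ← ih, nextInt_add hP hm]

/-! ### Absence of explosion -/

lemma IsBlock.stayInt_one_add_nextInt_one (hP : IsBlock P) (s : ℝ × TimedTree d)
    (hs : s.1 ≤ τ) : stayInt P τ 1 s + nextInt P τ 1 s = 1 := by
  have h1 : nextInt P τ 1 s =
      ENNReal.ofReal (1 - Real.exp (-((rate P s.2).toReal * (τ - s.1)))) := by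
    rw [← lintegral_exp_Ioc ENNReal.toReal_nonneg hs]
    refine lintegral_congr fun t => ?_
    simp only [Pi.one_apply, leafInt_const, mul_one]
    rw [mul_comm, ENNReal.ofReal_mul ENNReal.toReal_nonneg,
      ENNReal.ofReal_toReal (hP.rate_ne_top _)]
  rw [h1, stayInt, Pi.one_apply, mul_one, ← ENNReal.ofReal_add (Real.exp_nonneg _)]
  · simp
  · rw [sub_nonneg, Real.exp_le_one_iff, neg_nonpos]
    exact mul_nonneg ENNReal.toReal_nonneg (sub_nonneg.2 hs)

variable {L : Type} {cut : L → Cut d}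

lemma length_leaves (B : Set (EuclideanSpace ℝ (Fin d))) (T : BinaryTree L) :
    (leaves cut B T).length = T.numLeaves := by
  induction T generalizing B with
  | nil => rfl
  | node a l r hl hr => simp [leaves, hl, hr]

lemma numLeaves_of_mem_leaves {B : Set (EuclideanSpace ℝ (Fin d))} {T : BinaryTree L}
    {b : Set (EuclideanSpace ℝ (Fin d)) × (L → BinaryTree L)} (hb : b ∈ leaves cut B T) (x : L) :
    (b.2 x).numLeaves = T.numLeaves + 1 := by
  induction T generalizing B b with
  | nil =>
    simp only [leaves, List.mem_singleton] at hb
    rw [hb]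
    rfl
  | node a l r hl hr =>
    simp only [leaves, List.mem_append, List.mem_map] at hb
    rcases hb with ⟨b₀, hb₀, rfl⟩ | ⟨b₀, hb₀, rfl⟩
    · simp only [BinaryTree.numLeaves, hl hb₀]
      omega
    · simp only [BinaryTree.numLeaves, hr hb₀]
      omega

/-- With `m` terminal nodes, the probability of `n` more cuts within the budget is bounded as for
the Yule process, in which each of the terminal nodes is cut at the rate `λ` of the undivided block:
the expectation of `exp (-λ t)` at the waiting time `t` until the `n`-th of these cuts is at most
`m / (m + 1) * ... * (m + n - 1) / (m + n)`. -/
lemma IsBlock.iterate_nextInt_one_le (hP : IsBlock P) (n : ℕ) (s : ℝ × TimedTree d)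
    (hs : s.1 ≤ τ) : (nextInt P τ)^[n] 1 s ≤
      ENNReal.ofReal (Real.exp ((cutMeasure d (hit P)).toReal * (τ - s.1)) *
        (s.2.numLeaves / (s.2.numLeaves + n))) := by
  set lam := (cutMeasure d (hit P)).toReal with hlam
  have hlam0 : 0 ≤ lam := ENNReal.toReal_nonneg
  induction n generalizing s with
  | zero =>
    have : (0 : ℝ) < s.2.numLeaves := by exact_mod_cast s.2.numLeaves_pos
    rw [Nat.cast_zero, add_zero, div_self this.ne', mul_one]
    simp only [Function.iterate_zero, id, Pi.one_apply]
    rw [ENNReal.one_le_ofReal, Real.one_le_exp_iff]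
    exact mul_nonneg hlam0 (sub_nonneg.2 hs)
  | succ n ih =>
    rw [Function.iterate_succ_apply']
    have hm : (0 : ℝ) < s.2.numLeaves := by exact_mod_cast s.2.numLeaves_pos
    set m : ℝ := (s.2.numLeaves : ℝ)
    set v := (rate P s.2).toReal with hv
    have hv0 : 0 ≤ v := ENNReal.toReal_nonneg
    have hvm : v ≤ m * lam := by
      have := ENNReal.toReal_mono (ENNReal.mul_ne_top (by simp) hP.cutMeasure_hit_ne_top)
        (rate_le (P := P) s.2)
      rwa [length_leaves, ENNReal.toReal_mul, ENNReal.toReal_natCast] at this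
    set C : ℝ := Real.exp (lam * (τ - s.1)) * (m / (m + 1 + n)) with hC
    have hC0 : 0 ≤ C := by positivity
    calc nextInt P τ ((nextInt P τ)^[n] 1) s
        ≤ nextInt P τ (fun y => ENNReal.ofReal (Real.exp (lam * (τ - y.1)) *
            ((m + 1) / (m + 1 + n)))) s := by
          refine nextInt_mono fun t ht b hb c => ?_
          refine (ih (t, b.2 (t, c)) ht.2).trans_eq ?_
          simp only [numLeaves_of_mem_leaves hb]
          push_cast
          rfl
      _ ≤ ∫⁻ t in Ioc s.1 τ, ENNReal.ofReal C *
            ENNReal.ofReal ((v + lam) * Real.exp (-((v + lam) * (t - s.1)))) := by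
          refine lintegral_mono fun t => ?_
          simp only [leafInt_const]
          rw [← ENNReal.ofReal_toReal (hP.rate_ne_top s.2), ← hv,
            ENNReal.toReal_ofReal hv0, ← ENNReal.ofReal_mul hv0,
            ← ENNReal.ofReal_mul (Real.exp_nonneg _), ← ENNReal.ofReal_mul hC0]
          refine ENNReal.ofReal_le_ofReal ?_
          have hexp : Real.exp (-(v * (t - s.1))) * Real.exp (lam * (τ - t)) =
              Real.exp (lam * (τ - s.1)) * Real.exp (-((v + lam) * (t - s.1))) := by
            rw [← Real.exp_add, ← Real.exp_add]
            ring_nf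
          calc Real.exp (-(v * (t - s.1))) *
                (v * (Real.exp (lam * (τ - t)) * ((m + 1) / (m + 1 + n))))
              = (Real.exp (-(v * (t - s.1))) * Real.exp (lam * (τ - t))) *
                  (v * (m + 1) / (m + 1 + n)) := by ring
            _ ≤ (Real.exp (lam * (τ - s.1)) * Real.exp (-((v + lam) * (t - s.1)))) *
                  (m * (v + lam) / (m + 1 + n)) := by
                have hmul : v * (m + 1) ≤ m * (v + lam) := by linarith
                rw [hexp]
                gcongr ?_ * (?_ / ?_)
            _ = C * ((v + lam) * Real.exp (-((v + lam) * (t - s.1)))) := by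
                rw [hC]
                ring
      _ = ENNReal.ofReal C * ENNReal.ofReal (1 - Real.exp (-((v + lam) * (τ - s.1)))) := by
          rw [lintegral_const_mul' _ _ ENNReal.ofReal_ne_top, lintegral_exp_Ioc (by positivity) hs]
      _ ≤ ENNReal.ofReal C * 1 := by
          gcongr
          rw [ENNReal.ofReal_le_one]
          linarith [Real.exp_nonneg (-((v + lam) * (τ - s.1)))]
      _ = _ := by
          rw [mul_one, hC]
          push_cast
          ring_nf

lemma IsBlock.tendsto_iterate_nextInt_one (hP : IsBlock P) (s : ℝ × TimedTree d)
    (hs : s.1 ≤ τ) :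
    Filter.Tendsto (fun n => (nextInt P τ)^[n] 1 s) Filter.atTop (nhds 0) := by
  refine tendsto_of_tendsto_of_tendsto_of_le_of_le tendsto_const_nhds ?_ (fun n => zero_le)
    (fun n => hP.iterate_nextInt_one_le n s hs)
  rw [← ENNReal.ofReal_zero]
  refine ENNReal.tendsto_ofReal ?_
  have h1 : Filter.Tendsto (fun n : ℕ => (s.2.numLeaves : ℝ) + n) Filter.atTop Filter.atTop :=
    Filter.tendsto_atTop_add_const_left _ _ tendsto_natCast_atTop_atTop
  have h2 := (h1.const_div_atTop (s.2.numLeaves : ℝ)).const_mul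
    (Real.exp ((cutMeasure d (hit P)).toReal * (τ - s.1)))
  simpa using h2

lemma IsBlock.sum_iterate_stayInt_one (hP : IsBlock P) (s : ℝ × TimedTree d) (hs : s.1 ≤ τ)
    (N : ℕ) : ∑ n ∈ Finset.range N, (nextInt P τ)^[n] (stayInt P τ 1) s +
      (nextInt P τ)^[N] 1 s = 1 := by
  induction N with
  | zero => simp
  | succ N ih =>
    have hm := measurable_stayInt (τ := τ) hP.hitMeasurable (measurable_one (α := ℝ≥0∞))
    rw [Finset.sum_range_succ, add_assoc, Function.iterate_succ_apply, ← Pi.add_apply,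
      ← iterate_nextInt_add hP.hitMeasurable hm, ← ih]
    congr 1
    exact iterate_nextInt_congr (fun s hs => hP.stayInt_one_add_nextInt_one s hs) N s hs

/-- The process stops after finitely many cuts almost surely. -/
lemma IsBlock.isProbabilityMeasure_law (hd : 2 ≤ d) (hP : IsBlock P) (hτ : 0 ≤ τ) :
    IsProbabilityMeasure (law P τ) := by
  refine ⟨?_⟩
  rw [← lintegral_one, ← Pi.one_def, hP.lintegral_law hd hτ measurable_one]
  have hsum := hP.sum_iterate_stayInt_one (τ := τ) (0, .nil) hτ
  refine le_antisymm ?_ ?_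
  · exact ENNReal.tsum_le_of_sum_range_le fun N => (hsum N) ▸ le_self_add
  · have hlim := (hP.tendsto_iterate_nextInt_one (τ := τ) (0, .nil) hτ).const_add
      (∑' n, (nextInt P τ)^[n] (stayInt P τ 1) (0, .nil))
    rw [add_zero] at hlim
    refine ge_of_tendsto' hlim fun N => ?_
    rw [← hsum N]
    gcongr
    exact ENNReal.sum_le_tsum _

end Law

/-! ### Uniformisation -/

section Uniformisation

/-- A function that satisfies the renewal equation of a jump process with rate `v` also satisfies
the one in which fictitious jumps, which leave the state unchanged, occur at rate `δ`. -/
lemma uniformisation {v δ : ℝ} (hδ : 0 ≤ δ) {s τ : ℝ} (hs : s ≤ τ) {F : ℝ≥0∞}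
    {j h : ℝ → ℝ≥0∞} (hj : Measurable j)
    (hh : ∀ t ∈ Icc s τ, h t = ENNReal.ofReal (Real.exp (-(v * (τ - t)))) * F +
      ∫⁻ r in Ioc t τ, ENNReal.ofReal (Real.exp (-(v * (r - t)))) * j r) :
    ENNReal.ofReal (Real.exp (-((v + δ) * (τ - s)))) * F +
      ∫⁻ t in Ioc s τ, ENNReal.ofReal (Real.exp (-((v + δ) * (t - s)))) *
        (j t + ENNReal.ofReal δ * h t) = h s := by
  have hsplit : ∀ x : ℝ, 0 ≤ x → ENNReal.ofReal (Real.exp (-((v + δ) * x))) +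
      ENNReal.ofReal (Real.exp (-(v * x))) * ENNReal.ofReal (1 - Real.exp (-(δ * x))) =
        ENNReal.ofReal (Real.exp (-(v * x))) := by
    intro x hx
    have h1 : 0 ≤ 1 - Real.exp (-(δ * x)) := by
      rw [sub_nonneg, Real.exp_le_one_iff, neg_nonpos]
      positivity
    rw [← ENNReal.ofReal_mul (Real.exp_nonneg _), ← ENNReal.ofReal_add (Real.exp_nonneg _)
      (mul_nonneg (Real.exp_nonneg _) h1), mul_sub, mul_one, ← Real.exp_add]
    congr 1
    rw [show -(v * x) + -(δ * x) = -((v + δ) * x) by ring]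
    ring
  -- The weight of a fictitious jump at `t` followed by no genuine jump until `r`.
  have hexp : ∀ t r : ℝ, ENNReal.ofReal (Real.exp (-((v + δ) * (t - s)))) * ENNReal.ofReal δ *
      ENNReal.ofReal (Real.exp (-(v * (r - t)))) =
        ENNReal.ofReal (Real.exp (-(v * (r - s)))) *
          ENNReal.ofReal (δ * Real.exp (-(δ * (t - s)))) := by
    intro t r
    rw [← ENNReal.ofReal_mul (Real.exp_nonneg _), ← ENNReal.ofReal_mul (by positivity),
      ← ENNReal.ofReal_mul (Real.exp_nonneg _)]
    congr 1
    have : Real.exp (-((v + δ) * (t - s))) * Real.exp (-(v * (r - t))) =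
        Real.exp (-(v * (r - s))) * Real.exp (-(δ * (t - s))) := by
      rw [← Real.exp_add, ← Real.exp_add]
      ring_nf
    linear_combination δ * this
  have hswap : ∫⁻ t in Ioc s τ, ∫⁻ r in Ioc t τ, ENNReal.ofReal (Real.exp (-(v * (r - s)))) *
        ENNReal.ofReal (δ * Real.exp (-(δ * (t - s)))) * j r =
      ∫⁻ r in Ioc s τ, ENNReal.ofReal (Real.exp (-(v * (r - s)))) *
        ENNReal.ofReal (1 - Real.exp (-(δ * (r - s)))) * j r := by
    set G : ℝ → ℝ → ℝ≥0∞ := fun t r => ENNReal.ofReal (Real.exp (-(v * (r - s)))) *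
        ENNReal.ofReal (δ * Real.exp (-(δ * (t - s)))) * j r with hG
    have hGm : Measurable (Function.uncurry G) := by
      simp only [hG, Function.uncurry_def]
      fun_prop
    have hset : MeasurableSet {w : ℝ × ℝ | s < w.1 ∧ w.1 < w.2 ∧ w.2 ≤ τ} :=
      (measurableSet_lt measurable_const measurable_fst).inter
        ((measurableSet_lt measurable_fst measurable_snd).inter
          (measurableSet_le measurable_snd measurable_const))
    calc ∫⁻ t in Ioc s τ, ∫⁻ r in Ioc t τ, G t r
        = ∫⁻ t, ∫⁻ r, {w : ℝ × ℝ | s < w.1 ∧ w.1 < w.2 ∧ w.2 ≤ τ}.indicator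
            (Function.uncurry G) (t, r) := by
          rw [← lintegral_indicator measurableSet_Ioc]
          refine lintegral_congr fun t => ?_
          by_cases ht : t ∈ Ioc s τ
          · rw [indicator_of_mem ht, ← lintegral_indicator measurableSet_Ioc]
            refine lintegral_congr fun r => ?_
            simp only [indicator_apply, mem_Ioc, mem_ofPred_eq, ht.1, true_and]
            rfl
          · rw [indicator_of_notMem ht]
            symm
            rw [lintegral_eq_zero_iff']
            · refine .of_forall fun r => ?_
              refine indicator_of_notMem ?_ _
              rintro ⟨h1, h2, h3⟩
              exact ht ⟨h1, (h2.le.trans h3 : t ≤ τ)⟩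
            · exact ((hGm.indicator hset).comp measurable_prodMk_left).aemeasurable
      _ = ∫⁻ r, ∫⁻ t, {w : ℝ × ℝ | s < w.1 ∧ w.1 < w.2 ∧ w.2 ≤ τ}.indicator
            (Function.uncurry G) (t, r) :=
          lintegral_lintegral_swap (hGm.indicator hset).aemeasurable
      _ = ∫⁻ r in Ioc s τ, ENNReal.ofReal (Real.exp (-(v * (r - s)))) *
            ENNReal.ofReal (1 - Real.exp (-(δ * (r - s)))) * j r := by
          rw [← lintegral_indicator measurableSet_Ioc]
          refine lintegral_congr fun r => ?_
          by_cases hr : r ∈ Ioc s τ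
          · rw [indicator_of_mem hr, ← lintegral_exp_Ioc hδ hr.1.le,
              setLIntegral_congr Ioo_ae_eq_Ioc.symm, mul_right_comm,
              ← lintegral_const_mul _ (by fun_prop), ← lintegral_indicator measurableSet_Ioo]
            refine lintegral_congr fun t => ?_
            simp only [indicator_apply, mem_Ioo, mem_ofPred_eq, hr.2, and_true]
            refine if_congr Iff.rfl ?_ rfl
            simp only [Function.uncurry, hG]
            ring
          · rw [indicator_of_notMem hr, lintegral_eq_zero_iff']
            · refine .of_forall fun t => ?_
              refine indicator_of_notMem ?_ _
              rintro ⟨h1, h2, h3⟩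
              exact hr ⟨(h1.trans h2 : s < r), h3⟩
            · exact ((hGm.indicator hset).comp measurable_prodMk_right).aemeasurable
  have hfirst : ∫⁻ t in Ioc s τ, ENNReal.ofReal (Real.exp (-(v * (τ - s)))) *
        ENNReal.ofReal (δ * Real.exp (-(δ * (t - s)))) * F =
      ENNReal.ofReal (Real.exp (-(v * (τ - s)))) *
        ENNReal.ofReal (1 - Real.exp (-(δ * (τ - s)))) * F := by
    rw [lintegral_mul_const _ (by fun_prop), lintegral_const_mul _ (by fun_prop),
      lintegral_exp_Ioc hδ hs]
  have hinner : ∀ t ∈ Ioc s τ, ENNReal.ofReal (Real.exp (-((v + δ) * (t - s)))) *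
        (j t + ENNReal.ofReal δ * h t) =
      ENNReal.ofReal (Real.exp (-((v + δ) * (t - s)))) * j t +
        (ENNReal.ofReal (Real.exp (-(v * (τ - s)))) *
          ENNReal.ofReal (δ * Real.exp (-(δ * (t - s)))) * F +
        ∫⁻ r in Ioc t τ, ENNReal.ofReal (Real.exp (-(v * (r - s)))) *
          ENNReal.ofReal (δ * Real.exp (-(δ * (t - s)))) * j r) := by
    intro t ht
    rw [hh t ⟨ht.1.le, ht.2⟩, mul_add, mul_add, mul_add, ← mul_assoc, ← mul_assoc, ← mul_assoc,
      hexp,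
      ← lintegral_const_mul' _ _ (ENNReal.mul_ne_top ENNReal.ofReal_ne_top ENNReal.ofReal_ne_top)]
    congr 2
    refine lintegral_congr fun r => ?_
    rw [← mul_assoc, hexp]
  rw [setLIntegral_congr_fun measurableSet_Ioc hinner, lintegral_add_left (by fun_prop),
    lintegral_add_left (by fun_prop), hswap, hfirst, hh s ⟨le_rfl, hs⟩]
  have h1 : ENNReal.ofReal (Real.exp (-(v * (τ - s)))) * F =
      ENNReal.ofReal (Real.exp (-((v + δ) * (τ - s)))) * F +
        ENNReal.ofReal (Real.exp (-(v * (τ - s)))) *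
          ENNReal.ofReal (1 - Real.exp (-(δ * (τ - s)))) * F := by
    rw [← add_mul, hsplit _ (sub_nonneg.2 hs)]
  have h2 : ∫⁻ r in Ioc s τ, ENNReal.ofReal (Real.exp (-(v * (r - s)))) * j r =
      (∫⁻ r in Ioc s τ, ENNReal.ofReal (Real.exp (-((v + δ) * (r - s)))) * j r) +
        ∫⁻ r in Ioc s τ, ENNReal.ofReal (Real.exp (-(v * (r - s)))) *
          ENNReal.ofReal (1 - Real.exp (-(δ * (r - s)))) * j r := by
    rw [← lintegral_add_left (by fun_prop)]
    refine setLIntegral_congr_fun measurableSet_Ioc fun r hr => ?_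
    rw [← add_mul, hsplit _ (sub_nonneg.2 hr.1.le)]
  rw [h1, h2]
  ring

end Uniformisation

/-! ### Restriction of the process -/

section Restriction

variable {d : ℕ} {P Q : Set (EuclideanSpace ℝ (Fin d))} {τ : ℝ}

/-- The times of the cuts lie in `[r, s]` and increase along the branches of the tree. -/
def TimesIn {d : ℕ} : ℝ → ℝ → TimedTree d → Prop
  | _, _, .nil => True
  | r, s, .node a T T' => r ≤ a.1 ∧ a.1 ≤ s ∧ TimesIn a.1 s T ∧ TimesIn a.1 s T'

lemma TimesIn.mono {r s t : ℝ} {T : TimedTree d} (h : TimesIn r s T) (hst : s ≤ t) :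
    TimesIn r t T := by
  induction T generalizing r with
  | nil => trivial
  | node a l r hl hr => exact ⟨h.1, h.2.1.trans hst, hl h.2.2.1, hr h.2.2.2⟩

lemma TimesIn.insert {B : Set (EuclideanSpace ℝ (Fin d))} {r s t : ℝ} {T : TimedTree d}
    (h : TimesIn r s T) (hrs : r ≤ s) (hst : s ≤ t)
    {b : Set (EuclideanSpace ℝ (Fin d)) × (ℝ × Cut d → TimedTree d)}
    (hb : b ∈ leaves Prod.snd B T) (c : Cut d) : TimesIn r t (b.2 (t, c)) := by
  induction T generalizing B r b with
  | nil =>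
    simp only [leaves, List.mem_singleton] at hb
    rw [hb]
    exact ⟨hrs.trans hst, le_rfl, trivial, trivial⟩
  | node a l r hl hr =>
    simp only [leaves, List.mem_append, List.mem_map] at hb
    rcases hb with ⟨b₀, hb₀, rfl⟩ | ⟨b₀, hb₀, rfl⟩
    · exact ⟨h.1, h.2.1.trans hst, hl h.2.2.1 h.2.1 hb₀, h.2.2.2.mono hst⟩
    · exact ⟨h.1, h.2.1.trans hst, h.2.2.1.mono hst, hr h.2.2.2 h.2.1 hb₀⟩

lemma TimesIn.at_restrictBy_eq_nil {r s t : ℝ} {T : TimedTree d} (h : TimesIn r s T) (ht : t < r) :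
    TimedTree.at t (restrictBy Prod.snd Q T) = .nil := by
  induction T generalizing r Q with
  | nil => rfl
  | node a l r hl hr =>
    rw [restrictBy]
    split_ifs
    · exact hl h.2.2.1 (ht.trans_le h.1)
    · exact hr h.2.2.2 (ht.trans_le h.1)
    · rw [TimedTree.at, if_neg (not_le.2 (ht.trans_le h.1))]

/-- Restriction commutes with forgetting the cuts after time `t`. -/
lemma TimesIn.restrict_at {r s : ℝ} {T : TimedTree d} (h : TimesIn r s T) (t : ℝ) :
    restrict Q (T.at t) = TimedTree.at t (restrictBy Prod.snd Q T) := by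
  induction T generalizing r Q with
  | nil => rfl
  | node a l l' hl hr =>
    by_cases ha : a.1 ≤ t
    · rw [TimedTree.at, if_pos ha, restrict, restrictBy]
      split_ifs
      · exact hl h.2.2.1
      · exact hr h.2.2.2
      · rw [TimedTree.at, if_pos ha, hl h.2.2.1, hr h.2.2.2]
    · have h' : TimesIn a.1 s (.node a l l') := ⟨le_rfl, h.2⟩
      rw [h'.at_restrictBy_eq_nil (not_le.1 ha), TimedTree.at, if_neg ha, restrict]

/-- The cuts of a partition of `B` which are visible in its restriction to `Q ⊆ B` are those of
the restricted partition, with the same intensity; the other ones leave the restricted partition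
unchanged, and have some total intensity `δ`. -/
lemma exists_leafInt_restrictBy_eq {B : Set (EuclideanSpace ℝ (Fin d))} (hQ : Convex ℝ Q)
    (hQm : HitMeasurable fun _ : Unit => Q) (hBm : HitMeasurable fun _ : Unit => B) (hQB : Q ⊆ B)
    (T : TimedTree d) : ∃ δ : ℝ≥0∞, ∀ (t : ℝ) (φ : TimedTree d → ℝ≥0∞),
      leafInt B t (fun T' => φ (restrictBy Prod.snd Q T')) T =
        leafInt Q t φ (restrictBy Prod.snd Q T) + δ * φ (restrictBy Prod.snd Q T) := by
  induction T generalizing Q B with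
  | nil =>
    refine ⟨cutMeasure d (hit B \ hit Q), fun t φ => ?_⟩
    have hmQ := hQm.measurableSet_hit_const
    have hmB := hBm.measurableSet_hit_const
    simp only [restrictBy, leafInt_nil]
    rw [← lintegral_inter_add_sdiff _ (hit B) hmQ, inter_eq_right.2 (hit_mono hQB)]
    congr 1
    · refine setLIntegral_congr_fun hmQ fun c hc => ?_
      have h1 : ¬Q ⊆ c.neg := fun h => notMem_hit_of_subset_neg h hc
      have h2 : ¬Q ⊆ c.pos := fun h => notMem_hit_of_subset_pos h hc
      simp only [h1, h2, if_false]
    · rw [mul_comm, ← setLIntegral_const]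
      refine setLIntegral_congr_fun (hmB.diff hmQ) fun c hc => ?_
      by_cases h1 : Q ⊆ c.neg
      · simp only [h1, if_true]
      · have h2 : Q ⊆ c.pos := by
          by_contra h2
          exact hc.2 (mem_hit_of_not_subset hQ h1 h2)
        simp only [h1, h2, if_true, if_false]
  | node a l r hl hr =>
    have hBneg := hBm.cut_neg (c := fun _ => a.2) measurable_const
    have hBpos := hBm.cut_pos (c := fun _ => a.2) measurable_const
    by_cases h1 : Q ⊆ a.2.neg
    · obtain ⟨δ, hδ⟩ := hl hQ hQm hBneg (subset_inter hQB h1)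
      refine ⟨δ + rate (B ∩ a.2.pos) r, fun t φ => ?_⟩
      rw [leafInt_node]
      simp only [restrictBy, h1, if_true]
      rw [hδ, leafInt_const, add_mul, add_assoc]
    · by_cases h2 : Q ⊆ a.2.pos
      · obtain ⟨δ, hδ⟩ := hr hQ hQm hBpos (subset_inter hQB h2)
        refine ⟨rate (B ∩ a.2.neg) l + δ, fun t φ => ?_⟩
        rw [leafInt_node]
        simp only [restrictBy, h1, h2, if_true, if_false]
        rw [hδ, leafInt_const, add_mul]
        ring
      · obtain ⟨δ, hδ⟩ := hl (hQ.inter a.2.convex_neg)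
          (hQm.cut_neg (c := fun _ => a.2) measurable_const) hBneg (inter_subset_inter_left _ hQB)
        obtain ⟨δ', hδ'⟩ := hr (hQ.inter a.2.convex_pos)
          (hQm.cut_pos (c := fun _ => a.2) measurable_const) hBpos (inter_subset_inter_left _ hQB)
        refine ⟨δ + δ', fun t φ => ?_⟩
        rw [leafInt_node]
        simp only [restrictBy, h1, h2, if_false]
        rw [hδ t (fun T' => φ (.node a T' (restrictBy Prod.snd (Q ∩ a.2.pos) r))),
          hδ' t (fun T' => φ (.node a (restrictBy Prod.snd (Q ∩ a.2.neg) l) T')), leafInt_node,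
          add_mul]
        ring

/-- The expectation of a function of the final partition, given the current state. -/
noncomputable def finalInt (P : Set (EuclideanSpace ℝ (Fin d))) (τ : ℝ) (f : TimedTree d → ℝ≥0∞)
    (s : ℝ × TimedTree d) : ℝ≥0∞ :=
  ∑' n, (nextInt P τ)^[n] (stayInt P τ f) s

lemma measurable_finalInt (hP : HitMeasurable fun _ : Unit => P) {f : TimedTree d → ℝ≥0∞}
    (hf : Measurable f) : Measurable (finalInt P τ f) :=
  Measurable.tsum fun n => measurable_iterate_nextInt hP (measurable_stayInt hP hf) n

lemma finalInt_eq (hP : HitMeasurable fun _ : Unit => P) {f : TimedTree d → ℝ≥0∞}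
    (hf : Measurable f) (s : ℝ × TimedTree d) :
    finalInt P τ f s = stayInt P τ f s + nextInt P τ (finalInt P τ f) s := by
  have hfin : finalInt P τ f = fun s => ∑' n, (nextInt P τ)^[n] (stayInt P τ f) s := rfl
  conv_rhs => rw [hfin]
  rw [nextInt_tsum hP fun n => measurable_iterate_nextInt hP (measurable_stayInt hP hf) n,
    finalInt, tsum_eq_zero_add' ENNReal.summable]
  simp only [Function.iterate_succ_apply', Function.iterate_zero, id]

/-- In terms of the restricted partition, the expectation for the process on `Q` solves the
backward equation of the process on `P`. -/
lemma finalInt_restrictBy (hP : IsBlock P) (hQ : IsBlock Q) (hQP : Q ⊆ P)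
    {f : TimedTree d → ℝ≥0∞} (hf : Measurable f) {s : ℝ × TimedTree d} (hs : s.1 ≤ τ) :
    stayInt P τ (fun T => f (restrictBy Prod.snd Q T)) s +
      nextInt P τ (fun y => finalInt Q τ f (y.1, restrictBy Prod.snd Q y.2)) s =
        finalInt Q τ f (s.1, restrictBy Prod.snd Q s.2) := by
  obtain ⟨δ, hδ⟩ := exists_leafInt_restrictBy_eq hQ.convex hQ.hitMeasurable hP.hitMeasurable hQP s.2
  have hrate : rate P s.2 = rate Q (restrictBy Prod.snd Q s.2) + δ := by
    simpa only [rate, mul_one] using hδ 0 fun _ => 1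
  have hδtop : δ ≠ ∞ := ne_top_of_le_ne_top (hP.rate_ne_top s.2) (hrate ▸ le_add_self)
  have hreal : (rate P s.2).toReal = (rate Q (restrictBy Prod.snd Q s.2)).toReal + δ.toReal := by
    rw [hrate, ENNReal.toReal_add (hQ.rate_ne_top _) hδtop]
  have hfm := measurable_finalInt (τ := τ) hQ.hitMeasurable hf
  have hjm : Measurable fun t => leafInt Q t (fun T => finalInt Q τ f (t, T))
      (restrictBy Prod.snd Q s.2) :=
    (measurable_leafInt_section hQ.hitMeasurable hfm).comp
      (f := fun t : ℝ => (t, restrictBy Prod.snd Q s.2)) (by fun_prop)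
  have := uniformisation (s := s.1) (τ := τ)
    (v := (rate Q (restrictBy Prod.snd Q s.2)).toReal) (δ := δ.toReal)
    ENNReal.toReal_nonneg hs (F := f (restrictBy Prod.snd Q s.2))
    (h := fun t => finalInt Q τ f (t, restrictBy Prod.snd Q s.2)) hjm
    (fun t _ => finalInt_eq hQ.hitMeasurable hf _)
  rw [← this, stayInt, nextInt, hreal, ENNReal.ofReal_toReal hδtop]
  congr 1
  refine lintegral_congr fun t => ?_
  rw [hδ t fun T => finalInt Q τ f (t, T)]

/-- The partial sums of the iterated integrals of the process on `P` stay below every nonnegative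
solution of its backward equation, in particular below that of `finalInt_restrictBy`. -/
lemma sum_iterate_le_finalInt (hP : IsBlock P) (hQ : IsBlock Q) (hQP : Q ⊆ P)
    {f g : TimedTree d → ℝ≥0∞} (hf : Measurable f) (hg : Measurable g)
    (hgf : ∀ s T, TimesIn 0 s T → g T = f (restrictBy Prod.snd Q T)) (N : ℕ)
    (s : ℝ × TimedTree d) (hs0 : 0 ≤ s.1) (hs : s.1 ≤ τ) (hT : TimesIn 0 s.1 s.2) :
    (∑ n ∈ Finset.range N, (nextInt P τ)^[n] (stayInt P τ g)) s ≤
      finalInt Q τ f (s.1, restrictBy Prod.snd Q s.2) := by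
  induction N generalizing s with
  | zero => simp
  | succ N ih =>
    rw [Finset.sum_range_succ']
    simp only [Function.iterate_succ_apply', Function.iterate_zero, id]
    rw [← nextInt_sum_range hP.hitMeasurable fun n =>
        measurable_iterate_nextInt hP.hitMeasurable (measurable_stayInt hP.hitMeasurable hg) n,
      Pi.add_apply, add_comm, ← finalInt_restrictBy hP hQ hQP hf hs]
    refine add_le_add ?_ (nextInt_mono fun t ht b hb c => ?_)
    · rw [stayInt, stayInt, hgf s.1 s.2 hT]
    · exact ih (t, b.2 (t, c)) (hs0.trans ht.1.le) ht.2 (hT.insert hs0 ht.1.le hb c)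

lemma lintegral_law_le (hd : 2 ≤ d) (hP : IsBlock P) (hQ : IsBlock Q) (hQP : Q ⊆ P) (hτ : 0 ≤ τ)
    {f g : TimedTree d → ℝ≥0∞} (hf : Measurable f) (hg : Measurable g)
    (hgf : ∀ s T, TimesIn 0 s T → g T = f (restrictBy Prod.snd Q T)) :
    ∫⁻ T, g T ∂law P τ ≤ ∫⁻ T, f T ∂law Q τ := by
  rw [hP.lintegral_law hd hτ hg, hQ.lintegral_law hd hτ hf]
  refine ENNReal.tsum_le_of_sum_range_le fun N => ?_
  have := sum_iterate_le_finalInt hP hQ hQP hf hg hgf N (0, .nil) le_rfl hτ trivial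
  rw [Finset.sum_apply] at this
  exact this

end Restriction

end BSP

theorem proposition1 (d : ℕ) (hd : 2 ≤ d) (P Q : Set (EuclideanSpace ℝ (Fin d)))
    (hP : BSP.IsConvexPolyhedron P) (hQ : BSP.IsConvexPolyhedron Q) (hQP : Q ⊆ P)
    (τ : ℝ) (hτ : 0 < τ) :
    IsProbabilityMeasure (BSP.law P τ) ∧ IsProbabilityMeasure (BSP.law Q τ) ∧
      IdentDistrib
        (fun (ω : BSP.TimedTree d) (t : Set.Ioc (0 : ℝ) τ) => BSP.restrict Q (ω.at t))
        (fun (ω : BSP.TimedTree d) (t : Set.Ioc (0 : ℝ) τ) => ω.at t)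
        (BSP.law P τ) (BSP.law Q τ) := by
  have hpP := hP.isBlock.isProbabilityMeasure_law hd hτ.le
  have hpQ := hQ.isBlock.isProbabilityMeasure_law hd hτ.le
  have hat : ∀ t : ℝ, Measurable fun ω : BSP.TimedTree d => ω.at t := fun t =>
    BSP.measurable_at.comp measurable_prodMk_left
  have hres : Measurable (BSP.restrict Q) := by
    simp only [funext (BSP.restrict_eq_restrictBy Q)]
    exact (BSP.measurable_restrictBy measurable_id hQ.isBlock.hitMeasurable).comp
      (measurable_prodMk_left (x := ()))
  have hmQ : Measurable fun (ω : BSP.TimedTree d) (t : Set.Ioc (0 : ℝ) τ) => ω.at t :=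
    measurable_pi_lambda _ fun t => hat t
  have hmP : Measurable fun (ω : BSP.TimedTree d) (t : Set.Ioc (0 : ℝ) τ) =>
      BSP.restrict Q (ω.at t) := measurable_pi_lambda _ fun t => hres.comp (hat t)
  refine ⟨hpP, hpQ, hmP.aemeasurable, hmQ.aemeasurable, ?_⟩
  have h1 := Measure.isProbabilityMeasure_map (μ := BSP.law P τ) hmP.aemeasurable
  have h2 := Measure.isProbabilityMeasure_map (μ := BSP.law Q τ) hmQ.aemeasurable
  refine Measure.eq_of_le_of_isProbabilityMeasure (Measure.le_iff.2 fun A hA => ?_)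
  rw [← lintegral_indicator_one hA, ← lintegral_indicator_one hA,
    lintegral_map (measurable_one.indicator hA) hmP,
    lintegral_map (measurable_one.indicator hA) hmQ]
  refine BSP.lintegral_law_le hd hP.isBlock hQ.isBlock hQP hτ.le
    ((measurable_one.indicator hA).comp hmQ) ((measurable_one.indicator hA).comp hmP)
    fun s T hT => ?_
  simp only [hT.restrict_at]
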